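/- **Theorem (Nonterminating series identity).** Let $q,a,b,c,d\in\mathbb C\setminus\{0\}$ with $|q|<1$, and write $(x;q)_n=\prod_{i=0}^{n-1}(1-q^ix)$, $(x;q)_\infty=\prod_{i\ge0}(1-q^ix)$. Let $\varepsilon_b,\varepsilon_c,\varepsilon_d,\varepsilon_e,\lambda_b,\lambda_c,\lambda_d,\lambda_e$ be nonnegative integers and $\Lambda=\lambda_b+\lambda_c+\lambda_d+\lambda_e$. With $\langle n\rangle_x=\lfloor(\varepsilon_x+n\lambda_x)/\Lambda\rfloor$ for $x\in\{b,c,d,e\}$, suppose that $n=\langle n\rangle_b+\langle n\rangle_c+\langle n\rangle_d+\langle n\rangle_e$ for all integers $n\ge0$. Let $\delta$ be an integer with $0\le\delta<\Lambda$. Put $$\begin{aligned}\phi(x;n)={}&(bx;q)_{\langle n\rangle_b}(cx;q)_{\langle n\rangle_c}(dx;q)_{\langle n\rangle_d}\Big(\tfrac{qa^2x}{bcd};q\Big)_{\langle n\rangle_e}\\&\times\Big(\tfrac{b}{ax};q\Big)_{\langle n\rangle_b}\Big(\tfrac{c}{ax};q\Big)_{\langle n\rangle_c}\Big(\tfrac{d}{ax};q\Big)_{\langle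 n\rangle_d}\Big(\tfrac{qa}{bcdx};q\Big)_{\langle n\rangle_e},\end{aligned}$$ $$\Theta(m)=q^{\binom m2-\binom{\langle m\rangle_b}2-\binom{\langle m\rangle_c}2-\binom{\langle m\rangle_d}2-\binom{\langle m\rangle_e}2}\Big(\frac ab\Big)^{\langle m\rangle_b}\Big(\frac ac\Big)^{\langle m\rangle_c}\Big(\frac ad\Big)^{\langle m\rangle_d}\Big(\frac{bcd}{qa}\Big)^{\langle m\rangle_e},$$ $$\begin{aligned}H(n)={}&\frac{(b;q)_{\langle n\rangle_b}(c;q)_{\langle n\rangle_c}(d;q)_{\langle n\rangle_d}(qa^2/bcd;q)_{\langle n\rangle_e}}{(q;q)_n\,(bcd/a;q)_{\langle n\rangle_b+\langle n\rangle_c+\langle n\rangle_d}}\cdot\frac{(bc/a;q)_{\langle n\rangle_b+\langle n\rangle_c}(qa/bc;q)_{\langle n\rangle_d+\langle n\rangle_e}}{(qa/b;q)_{\langle n\rangle_c+\langle n\rangle_d+\langle n\rangle_e}}\\&\times\frac{(bd/a;q)_{\langle n\rangle_b+\langle n\rangle_d}(qa/bd;q)_{\langle n\rangle_c+\langle n\rangle_e}}{(qa/c;q)_{\langle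 n\rangle_b+\langle n\rangle_d+\langle n\rangle_e}}\cdot\frac{(cd/a;q)_{\langle n\rangle_c+\langle n\rangle_d}(qa/cd;q)_{\langle n\rangle_b+\langle n\rangle_e}}{(qa/d;q)_{\langle n\rangle_b+\langle n\rangle_c+\langle n\rangle_e}}.\end{aligned}$$ Assume that $(qa/b;q)_\infty,(qa/c;q)_\infty,(qa/d;q)_\infty,(bcd/a;q)_\infty$ are nonzero and that $\phi(q^k;k)\ne0$ for all $k\ge0$. If only one of the four $\lambda$'s is nonzero, assume moreover, for convergence, that $|a/b|<1$, $|a/c|<1$, $|a/d|<1$ or $|bcd/(qa)|<1$ according as that one is $\lambda_b$, $\lambda_c$, $\lambda_d$ or $\lambda_e$. Then $$\begin{aligned}\frac{(b,c,d,qa^2/bcd;q)_\infty}{(qa/b,qa/c,qa/d,bcd/a;q)_\infty}={}&\sum_{k=0}^{\delta-1}\Theta(k+1)\left\{\frac{\phi(q^k;k+1)}{-\phi(q^k;k)}\right\}H(k)\\&+\sum_{n=0}^\infty H(n\Lambda)\Theta(n\Lambda)\sum_{i=\delta}^{\delta-1+\Lambda}\frac{\Theta(1+i+n\Lambda)}{\Theta(n\Lambda)}\left\{\frac{\phi(q^{i+n\Lambda};1+i+n\Lambda)}{-\phi(q^{i+n\Lambda};i+n\Lambda)}\right\}\frac{H(i+n\Lambda)}{H(n\Lambda)},\end{aligned}$$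 where the series over $n$ converges absolutely (when $H(n\Lambda)=0$, also $H(i+n\Lambda)=0$ for all $i\ge0$, and the $n$-th term is read as $0$). -/

import Mathlib

open Finset

noncomputable section

/-- The finite `q`-shifted factorial `(x; q)_n = (1 - x)(1 - q x) ⋯ (1 - q^(n-1) x)`. -/
def qPoch (x q : ℂ) (n : ℕ) : ℂ := ∏ i ∈ range n, (1 - q ^ i * x)

/-- The infinite `q`-shifted factorial `(x; q)_∞` (a convergent product for `|q| < 1`). -/
def qPochInf (x q : ℂ) : ℂ := ∏' i : ℕ, (1 - q ^ i * x)

/-- For `|q| < 1` the product in `qPochInf` converges, so that it is not a default value. -/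
theorem multipliable_qPochInf (x : ℂ) {q : ℂ} (hq : ‖q‖ < 1) :
    Multipliable fun i : ℕ => 1 - q ^ i * x := by
  have h : Summable fun i : ℕ => ‖-(q ^ i * x)‖ := by
    simp only [norm_neg, norm_mul, norm_pow]
    exact (summable_geometric_of_lt_one (norm_nonneg q) hq).mul_right _
  simpa [sub_eq_add_neg] using multipliable_one_add_of_summable h

/-- Eight nonnegative integers `ε_b, ε_c, ε_d, ε_e, λ_b, λ_c, λ_d, λ_e`. -/
structure PatternData where
  epsB : ℕ
  epsC : ℕ
  epsD : ℕ
  epsE : ℕ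
  lamB : ℕ
  lamC : ℕ
  lamD : ℕ
  lamE : ℕ

namespace PatternData

/-- `Λ = λ_b + λ_c + λ_d + λ_e`. -/
def Lam (P : PatternData) : ℕ := P.lamB + P.lamC + P.lamD + P.lamE

/-- `⟨n⟩_b = ⌊(ε_b + n λ_b) / Λ⌋` (division of natural numbers rounds down). -/
def nb (P : PatternData) (n : ℕ) : ℕ := (P.epsB + n * P.lamB) / P.Lam

/-- `⟨n⟩_c = ⌊(ε_c + n λ_c) / Λ⌋`. -/
def nc (P : PatternData) (n : ℕ) : ℕ := (P.epsC + n * P.lamC) / P.Lam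

/-- `⟨n⟩_d = ⌊(ε_d + n λ_d) / Λ⌋`. -/
def nd (P : PatternData) (n : ℕ) : ℕ := (P.epsD + n * P.lamD) / P.Lam

/-- `⟨n⟩_e = ⌊(ε_e + n λ_e) / Λ⌋`. -/
def ne (P : PatternData) (n : ℕ) : ℕ := (P.epsE + n * P.lamE) / P.Lam

/-- The data form a partition pattern: `n = ⟨n⟩_b + ⟨n⟩_c + ⟨n⟩_d + ⟨n⟩_e` for all `n ≥ 0`. -/
def IsPartition (P : PatternData) : Prop :=
  ∀ n : ℕ, n = P.nb n + P.nc n + P.nd n + P.ne n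

/-- The Laurent polynomials `φ(x; n)`. -/
def phi (P : PatternData) (q a b c d x : ℂ) (n : ℕ) : ℂ :=
  qPoch (b * x) q (P.nb n) * qPoch (c * x) q (P.nc n) * qPoch (d * x) q (P.nd n) *
    qPoch (q * a ^ 2 * x / (b * c * d)) q (P.ne n) *
  (qPoch (b / (a * x)) q (P.nb n) * qPoch (c / (a * x)) q (P.nc n) *
    qPoch (d / (a * x)) q (P.nd n) * qPoch (q * a / (b * c * d * x)) q (P.ne n))

/-- The monomial `Θ(m)`. -/
def Theta (P : PatternData) (q a b c d : ℂ) (m : ℕ) : ℂ :=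
  q ^ ((m.choose 2 : ℤ) - ((P.nb m).choose 2 : ℤ) - ((P.nc m).choose 2 : ℤ)
      - ((P.nd m).choose 2 : ℤ) - ((P.ne m).choose 2 : ℤ)) *
    ((a / b) ^ P.nb m * (a / c) ^ P.nc m * (a / d) ^ P.nd m * (b * c * d / (q * a)) ^ P.ne m)

/-- The quotient of shifted factorials `H(n)`. -/
def H (P : PatternData) (q a b c d : ℂ) (n : ℕ) : ℂ :=
  qPoch b q (P.nb n) * qPoch c q (P.nc n) * qPoch d q (P.nd n) *
      qPoch (q * a ^ 2 / (b * c * d)) q (P.ne n) /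
    (qPoch q q n * qPoch (b * c * d / a) q (P.nb n + P.nc n + P.nd n)) *
  (qPoch (b * c / a) q (P.nb n + P.nc n) * qPoch (q * a / (b * c)) q (P.nd n + P.ne n) /
    qPoch (q * a / b) q (P.nc n + P.nd n + P.ne n)) *
  (qPoch (b * d / a) q (P.nb n + P.nd n) * qPoch (q * a / (b * d)) q (P.nc n + P.ne n) /
    qPoch (q * a / c) q (P.nb n + P.nd n + P.ne n)) *
  (qPoch (c * d / a) q (P.nc n + P.nd n) * qPoch (q * a / (c * d)) q (P.nb n + P.ne n) /
    qPoch (q * a / d) q (P.nb n + P.nc n + P.ne n))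

end PatternData

end

/-! Put e = qa²/(bcd), so that bcde = qa², and take as nodes the values `node q a n` of x + 1/(ax)
at x = q^n. Each quotient φ(x; k+1)/φ(x; k) is affine in x + 1/(ax). The theorem is therefore a
Newton interpolation series with prescribed poles (`newton_expansion`). The interpolated values are
q^n times the n-th partial product `prodSide q a z n` of the left side. The coefficients are divided
differences of these values multiplied by φ(·; k).

What makes the series explicit is that all these divided differences have a closed form, `ddTable`.
It satisfies the recurrence of divided differences when any one of the four indices is raised. For b
this is `ddTable_step`, which reduces to the rational identity `three_term_relation`; the other
directions follow by symmetry in b, c, d, e. So every lattice path from the origin in ℕ⁴ gives an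
expansion, and the floor functions trace such a path (`exists_isPath`).

Evaluation at node n gives a finite sum with a remainder (`prodSide_eq_sum`). Newton's formula needs
distinct nodes, but its explicit form extends to all admissible a by continuity (`path_expansion`).
As n → ∞ the n-dependent factors tend to 1 and stay bounded uniformly in k ≤ n, while Σ|Θ(k)|
converges (`summable_norm_Theta`). Dominated convergence then gives the infinite series
(`hasSum_path`), and grouping its terms in blocks of length Λ gives the stated form. -/

noncomputable section

/-! ### Divided differences and Newton's expansion with prescribed poles -/

/-- The divided difference of `F` over the nodes `X j`, `j ∈ S`. -/
def divDiff (X : ℕ → ℂ) (S : Finset ℕ) (F : ℕ → ℂ) : ℂ :=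
  ∑ j ∈ S, F j * (∏ l ∈ S.erase j, (X j - X l))⁻¹

/-- Compare the coefficients of each `F j`. For `j ∈ T` this is the partial fraction decomposition
of (X t - X s)(α + βx)/((x - X s)(x - X t)) at x = X j; for `j = s` and `j = t` only one term occurs
on the right. -/
theorem divDiff_mul_affine {X : ℕ → ℂ} (hX : Function.Injective X) {T : Finset ℕ} {s t : ℕ}
    (hs : s ∉ T) (ht : t ∉ T) (hst : s ≠ t) (α β : ℂ) (F : ℕ → ℂ) :
    (X t - X s) * divDiff X (insert s (insert t T)) (fun j => (α + β * X j) * F j) =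
      (α + β * X t) * divDiff X (insert t T) F - (α + β * X s) * divDiff X (insert s T) F := by
  have hsub : ∀ {i j}, i ≠ j → X i - X j ≠ 0 := fun h => sub_ne_zero.2 (hX.ne h)
  have hs' : s ∉ insert t T := by simp [hst, hs]
  have hT : ∀ r ∉ T, ∀ r', r' ∉ T → r ≠ r' → ∀ j ∈ T,
      ∏ l ∈ (insert r T).erase j, (X j - X l) = (X j - X r) * ∏ l ∈ T.erase j, (X j - X l) := by
    intro r hr r' _ _ j hj
    have hjr : j ≠ r := fun h => hr (h ▸ hj)
    rw [erase_insert_of_ne hjr.symm, prod_insert (fun h => hr (mem_of_mem_erase h))]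
  unfold divDiff
  rw [sum_insert hs', sum_insert ht, sum_insert ht, sum_insert hs, erase_insert hs',
    erase_insert ht, erase_insert hs, erase_insert_of_ne hst, erase_insert ht,
    prod_insert ht, prod_insert hs]
  have h1 : ∑ j ∈ T, (α + β * X j) * F j *
        (∏ l ∈ (insert s (insert t T)).erase j, (X j - X l))⁻¹ =
      ∑ j ∈ T, (α + β * X j) * F j *
        ((X j - X s) * ((X j - X t) * ∏ l ∈ T.erase j, (X j - X l)))⁻¹ := by
    refine sum_congr rfl fun j hj => ?_
    have hjs : j ≠ s := fun h => hs (h ▸ hj)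
    have hjt : j ≠ t := fun h => ht (h ▸ hj)
    rw [erase_insert_of_ne hjs.symm, prod_insert (fun h => hs' (mem_of_mem_erase h)),
      hT t ht s hs hst.symm j hj]
  have h2 : ∀ r ∉ T, ∑ j ∈ T, F j * (∏ l ∈ (insert r T).erase j, (X j - X l))⁻¹ =
      ∑ j ∈ T, F j * ((X j - X r) * ∏ l ∈ T.erase j, (X j - X l))⁻¹ := by
    intro r hr
    refine sum_congr rfl fun j hj => ?_
    have hjr : j ≠ r := fun h => hr (h ▸ hj)
    rw [erase_insert_of_ne hjr.symm, prod_insert (fun h => hr (mem_of_mem_erase h))]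
  have h3 : (X t - X s) * ∑ j ∈ T, (α + β * X j) * F j *
        ((X j - X s) * ((X j - X t) * ∏ l ∈ T.erase j, (X j - X l)))⁻¹ =
      (α + β * X t) * ∑ j ∈ T, F j * ((X j - X t) * ∏ l ∈ T.erase j, (X j - X l))⁻¹ -
      (α + β * X s) * ∑ j ∈ T, F j * ((X j - X s) * ∏ l ∈ T.erase j, (X j - X l))⁻¹ := by
    rw [mul_sum, mul_sum, mul_sum, ← sum_sub_distrib]
    refine sum_congr rfl fun j hj => ?_
    have hjs := hsub (i := j) (j := s) fun h => hs (h ▸ hj)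
    have hjt := hsub (i := j) (j := t) fun h => ht (h ▸ hj)
    simp only [mul_inv]
    field_simp
    ring
  rw [h1, h2 t ht, h2 s hs]
  have e1 := hsub hst
  have e2 := hsub hst.symm
  simp only [mul_inv, mul_add] at h3 ⊢
  rw [h3]
  have h4 : X t - X s = -(X s - X t) := by ring
  rw [h4] at e2 ⊢
  rw [inv_neg]
  field_simp
  ring

/-- A triangular array that obeys the recurrence of divided differences consists of them. -/
theorem eq_divDiff_of_recurrence {X : ℕ → ℂ} (hX : Function.Injective X) (α β : ℕ → ℂ)
    (P : ℕ → ℕ → ℂ)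
    (hP : ∀ k i, (X (i + k + 1) - X i) * P (k + 1) i =
      (α k + β k * X (i + k + 1)) * P k (i + 1) - (α k + β k * X i) * P k i) (k i : ℕ) :
    P k i = divDiff X (Ico i (i + k + 1))
      (fun j => (∏ m ∈ range k, (α m + β m * X j)) * P 0 j) := by
  induction k generalizing i with
  | zero => simp [divDiff]
  | succ k ih =>
    have hne : X (i + k + 1) - X i ≠ 0 := sub_ne_zero.2 (hX.ne (by omega))
    apply mul_left_cancel₀ hne
    -- The two end nodes `i` and `i + k + 1` are split off; the middle block is common to all three
    -- divided differences.
    have e1 : Ico i (i + (k + 1) + 1) = insert i (insert (i + k + 1) (Ico (i + 1) (i + k + 1))) := by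
      ext; simp; omega
    have e2 : Ico i (i + k + 1) = insert i (Ico (i + 1) (i + k + 1)) := by ext; simp; omega
    have e3 : Ico (i + 1) (i + 1 + k + 1) = insert (i + k + 1) (Ico (i + 1) (i + k + 1)) := by
      ext; simp; omega
    rw [hP, ih, ih, e1, e2, e3, ← divDiff_mul_affine hX (by simp) (by simp) (by omega)]
    congr 2
    funext j
    rw [prod_range_succ]
    ring

/-- Newton's expansion with prescribed poles, at a node. -/
theorem newton_expansion {X : ℕ → ℂ} (hX : Function.Injective X) (α β : ℕ → ℂ)
    (P : ℕ → ℕ → ℂ)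
    (hP : ∀ k i, (X (i + k + 1) - X i) * P (k + 1) i =
      (α k + β k * X (i + k + 1)) * P k (i + 1) - (α k + β k * X i) * P k i) (n : ℕ) :
    P 0 n * ∏ m ∈ range n, (α m + β m * X n) =
      ∑ k ∈ range n, (α k + β k * X k) * P k 0 * (∏ j ∈ range k, (X n - X j)) *
        ∏ m ∈ Ico (k + 1) n, (α m + β m * X n) +
      P n 0 * ∏ j ∈ range n, (X n - X j) := by
  set F : ℕ → ℕ → ℂ := fun k j => (∏ m ∈ range k, (α m + β m * X j)) * P 0 j with hF
  have hPk : ∀ k, P k 0 = divDiff X (insert k (range k)) (F k) := by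
    intro k
    rw [eq_divDiff_of_recurrence hX α β P hP, ← range_add_one, zero_add, ← range_eq_Ico]
  -- The expansion stopped after `k` terms: node `n` stays in the last divided difference while the
  -- nodes below `k` are used up one by one.
  have main : ∀ k ≤ n, P 0 n * ∏ m ∈ range k, (α m + β m * X n) =
      ∑ k' ∈ range k, (α k' + β k' * X k') * P k' 0 * (∏ j ∈ range k', (X n - X j)) *
        ∏ m ∈ Ico (k' + 1) k, (α m + β m * X n) +
      divDiff X (insert n (range k)) (F k) * ∏ j ∈ range k, (X n - X j) := by
    intro k
    induction k with
    | zero => simp [divDiff, hF]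
    | succ k ih =>
      intro hk
      have h1 := divDiff_mul_affine hX (T := range k) (s := k) (t := n) (by simp)
        (by simp; omega) (by omega) (α k) (β k) (F k)
      have h2 : (fun j => (α k + β k * X j) * F k j) = F (k + 1) := by
        funext j
        simp only [hF, prod_range_succ]
        ring
      have h3 : insert k (insert n (range k)) = insert n (range (k + 1)) := by
        rw [range_add_one, insert_comm]
      rw [h2, h3, ← hPk] at h1
      have h4 : ∑ k' ∈ range k, (α k' + β k' * X k') * P k' 0 * (∏ j ∈ range k', (X n - X j)) *
            ∏ m ∈ Ico (k' + 1) (k + 1), (α m + β m * X n) =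
          (∑ k' ∈ range k, (α k' + β k' * X k') * P k' 0 * (∏ j ∈ range k', (X n - X j)) *
            ∏ m ∈ Ico (k' + 1) k, (α m + β m * X n)) * (α k + β k * X n) := by
        rw [sum_mul]
        refine sum_congr rfl fun k' hk' => ?_
        rw [prod_Ico_succ_top (by have := mem_range.1 hk'; omega)]
        ring
      rw [prod_range_succ, ← mul_assoc, ih (by omega), sum_range_succ, h4, prod_range_succ,
        Ico_self, prod_empty]
      linear_combination (∏ x ∈ range k, (X n - X x)) * (-h1)
  rw [main n le_rfl, hPk]

/-! ### The closed form of the divided differences -/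

theorem qPoch_succ (x q : ℂ) (n : ℕ) : qPoch x q (n + 1) = qPoch x q n * (1 - q ^ n * x) :=
  prod_range_succ _ _

theorem qPoch_zero (x q : ℂ) : qPoch x q 0 = 1 := prod_range_zero _

/-- This is the recurrence for `ddTable` after division by a common entry: `s` is q^i, `K` is
q^(k+1), and the parameters already carry the powers of q from their indices. The balancing
condition eliminates `e`, leaving a rational identity. -/
theorem three_term_relation {a b c d e s K : ℂ} (ha : a ≠ 0) (hb : b ≠ 0) (hc : c ≠ 0)
    (hd : d ≠ 0) (hs : s ≠ 0) (hK : K ≠ 0) (hK1 : 1 - K ≠ 0) (h : b * c * d * e = K * a ^ 2) :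
    (s * K + 1 / (a * (s * K)) - (s + 1 / (a * s))) * (-a * (K * s) / (1 - K)) *
        ((1 - b * c / a) * (1 - b * d / a) * (1 - b * e / a)) *
        ((1 - s * b) * (1 - s * K * a / b)) =
      (1 + b ^ 2 / a - b * (s * K + 1 / (a * (s * K)))) *
          (K * ((1 - s * b) * (1 - s * c) * (1 - s * d) * (1 - s * e))) -
        (1 + b ^ 2 / a - b * (s + 1 / (a * s))) *
          ((1 - s * K * a / b) * (1 - s * K * a / c) * (1 - s * K * a / d) *
            (1 - s * K * a / e)) := by
  have he : e = K * a ^ 2 / (b * c * d) := by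
    field_simp
    linear_combination h
  subst he
  field_simp
  ring

/-- The nodes of the interpolation. -/
def node (q a : ℂ) (n : ℕ) : ℂ := q ^ n + 1 / (a * q ^ n)

/-- The closed form of the divided differences, with `k = nb + nc + nd + ne`. -/
def ddTable (q a b c d e : ℂ) (nb nc nd ne i : ℕ) : ℂ :=
  (-a) ^ (nb + nc + nd + ne) *
      q ^ ((nb + nc + nd + ne + 1).choose 2 + i * (nb + nc + nd + ne + 1)) /
      qPoch q q (nb + nc + nd + ne) *
    (qPoch (b * c / a) q (nb + nc) * qPoch (b * d / a) q (nb + nd) *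
      qPoch (b * e / a) q (nb + ne) * qPoch (c * d / a) q (nc + nd) *
      qPoch (c * e / a) q (nc + ne) * qPoch (d * e / a) q (nd + ne)) *
    (qPoch b q (i + nb) * qPoch c q (i + nc) * qPoch d q (i + nd) * qPoch e q (i + ne)) /
    (qPoch (q * a / b) q (i + (nc + nd + ne)) * qPoch (q * a / c) q (i + (nb + nd + ne)) *
      qPoch (q * a / d) q (i + (nb + nc + ne)) * qPoch (q * a / e) q (i + (nb + nc + nd)))

/-- Both neighbouring entries are the entry `C0` times finitely many linear factors (`t1`, `t2`), so
the recurrence reduces to `three_term_relation`. -/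
theorem ddTable_step {q a b c d e : ℂ} (hq : q ≠ 0) (ha : a ≠ 0) (hb : b ≠ 0) (hc : c ≠ 0)
    (hd : d ≠ 0) (he : e ≠ 0) (h : b * c * d * e = q * a ^ 2) (hqq : ∀ n, qPoch q q n ≠ 0)
    (hDb : ∀ n, qPoch (q * a / b) q n ≠ 0) (hDc : ∀ n, qPoch (q * a / c) q n ≠ 0)
    (hDd : ∀ n, qPoch (q * a / d) q n ≠ 0) (hDe : ∀ n, qPoch (q * a / e) q n ≠ 0)
    (nb nc nd ne i : ℕ) :
    (node q a (i + (nb + nc + nd + ne) + 1) - node q a i) *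
        ddTable q a b c d e (nb + 1) nc nd ne i =
      (1 + (q ^ nb * b) ^ 2 / a - q ^ nb * b * node q a (i + (nb + nc + nd + ne) + 1)) *
          ddTable q a b c d e nb nc nd ne (i + 1) -
        (1 + (q ^ nb * b) ^ 2 / a - q ^ nb * b * node q a i) *
          ddTable q a b c d e nb nc nd ne i := by
  have hfac : ∀ {x : ℂ}, (∀ n, qPoch x q n ≠ 0) → ∀ n, 1 - q ^ n * x ≠ 0 := by
    intro x hx n h0
    exact hx (n + 1) (by rw [qPoch_succ, h0, mul_zero])
  set k := nb + nc + nd + ne with hk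
  have hkq : q ^ (k + 1) = q * (q ^ nb * q ^ nc * q ^ nd * q ^ ne) := by
    rw [hk]; ring
  have hK1 : 1 - q ^ (k + 1) ≠ 0 := by simpa [pow_succ] using hfac hqq k
  have key := three_term_relation (a := a) (b := q ^ nb * b) (c := q ^ nc * c) (d := q ^ nd * d)
    (e := q ^ ne * e) (s := q ^ i) (K := q ^ (k + 1)) ha (by simp [hq, hb]) (by simp [hq, hc])
    (by simp [hq, hd]) (by simp [hq]) (by simp [hq]) hK1
    (by rw [hkq]; linear_combination (q ^ nb * q ^ nc * q ^ nd * q ^ ne) * h)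
  have rb : q ^ i * q ^ (k + 1) * a / (q ^ nb * b) = q ^ (i + (nc + nd + ne)) * (q * a / b) := by
    rw [hkq]; field_simp; ring
  have rc : q ^ i * q ^ (k + 1) * a / (q ^ nc * c) = q ^ (i + (nb + nd + ne)) * (q * a / c) := by
    rw [hkq]; field_simp; ring
  have rd : q ^ i * q ^ (k + 1) * a / (q ^ nd * d) = q ^ (i + (nb + nc + ne)) * (q * a / d) := by
    rw [hkq]; field_simp; ring
  have re : q ^ i * q ^ (k + 1) * a / (q ^ ne * e) = q ^ (i + (nb + nc + nd)) * (q * a / e) := by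
    rw [hkq]; field_simp; ring
  rw [rb, rc, rd, re] at key
  have n1 : node q a (i + k + 1) = q ^ i * q ^ (k + 1) + 1 / (a * (q ^ i * q ^ (k + 1))) := by
    rw [node, add_assoc, pow_add]
  have n0 : node q a i = q ^ i + 1 / (a * q ^ i) := rfl
  rw [← n1, ← n0] at key
  have fb := hfac hDb (i + (nc + nd + ne))
  have fc := hfac hDc (i + (nb + nd + ne))
  have fd := hfac hDd (i + (nb + nc + ne))
  have fe := hfac hDe (i + (nb + nc + nd))
  set C0 := ddTable q a b c d e nb nc nd ne i with hC0
  have t1 : ddTable q a b c d e nb nc nd ne (i + 1) =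
      C0 * (q ^ (k + 1) * ((1 - q ^ i * (q ^ nb * b)) * (1 - q ^ i * (q ^ nc * c)) *
        (1 - q ^ i * (q ^ nd * d)) * (1 - q ^ i * (q ^ ne * e)))) /
        ((1 - q ^ (i + (nc + nd + ne)) * (q * a / b)) *
          (1 - q ^ (i + (nb + nd + ne)) * (q * a / c)) *
          (1 - q ^ (i + (nb + nc + ne)) * (q * a / d)) *
          (1 - q ^ (i + (nb + nc + nd)) * (q * a / e))) := by
    rw [hC0, ddTable, ddTable, ← hk]
    simp only [add_right_comm i 1, qPoch_succ, Nat.add_mul, one_mul]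
    rw [← add_assoc (Nat.choose _ 2), pow_add _ _ (k + 1), pow_add q i nb, pow_add q i nc,
      pow_add q i nd, pow_add q i ne]
    simp only [div_eq_mul_inv _ (_ * _), mul_inv]
    ring
  have t2 : ddTable q a b c d e (nb + 1) nc nd ne i =
      C0 * ((-a * (q ^ (k + 1) * q ^ i) / (1 - q ^ (k + 1))) *
        ((1 - q ^ nb * b * (q ^ nc * c) / a) * (1 - q ^ nb * b * (q ^ nd * d) / a) *
          (1 - q ^ nb * b * (q ^ ne * e) / a)) * (1 - q ^ i * (q ^ nb * b))) /
        ((1 - q ^ (i + (nb + nd + ne)) * (q * a / c)) *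
          (1 - q ^ (i + (nb + nc + ne)) * (q * a / d)) *
          (1 - q ^ (i + (nb + nc + nd)) * (q * a / e))) := by
    have i1 : nb + 1 + nc + nd + ne = k + 1 := by omega
    have i2 : (k + 1 + 1).choose 2 + i * (k + 1 + 1) =
        (k + 1).choose 2 + i * (k + 1) + (k + 1) + i := by
      rw [Nat.choose_succ_succ' (k + 1) 1, Nat.choose_one_right]; ring
    have i3 : nb + 1 + nc = nb + nc + 1 := by omega
    have i4 : nb + 1 + nd = nb + nd + 1 := by omega
    have i5 : nb + 1 + ne = nb + ne + 1 := by omega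
    have i6 : i + (nb + 1) = i + nb + 1 := by omega
    have i7 : i + (nb + 1 + nd + ne) = i + (nb + nd + ne) + 1 := by omega
    have i8 : i + (nb + 1 + nc + ne) = i + (nb + nc + ne) + 1 := by omega
    have i9 : i + (nb + 1 + nc + nd) = i + (nb + nc + nd) + 1 := by omega
    rw [hC0, ddTable, ddTable, i1, ← hk, i2, i6, i7, i8, i9, i3, i4, i5]
    simp only [qPoch_succ]
    rw [pow_add _ _ i, pow_add _ _ (k + 1), pow_add q i nb, pow_add q nb nc, pow_add q nb nd,
      pow_add q nb ne, ← pow_succ q k, pow_succ (-a) k]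
    simp only [div_eq_mul_inv _ (_ * _), mul_inv, div_eq_mul_inv _ (1 - (_ : ℂ)),
      div_eq_mul_inv _ (qPoch _ _ _)]
    ring
  rw [t1, t2]
  -- Only the four denominators `z1`, …, `z4` need clearing. The factor `z1` is absent from `t2`,
  -- since raising `nb` leaves `nc + nd + ne` unchanged, and so it appears on the left of `key`.
  generalize node q a (i + k + 1) = X1 at key ⊢
  generalize node q a i = X0 at key ⊢
  generalize (1 - q ^ (i + (nc + nd + ne)) * (q * a / b)) = z1 at *
  generalize (1 - q ^ (i + (nb + nd + ne)) * (q * a / c)) = z2 at *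
  generalize (1 - q ^ (i + (nb + nc + ne)) * (q * a / d)) = z3 at *
  generalize (1 - q ^ (i + (nb + nc + nd)) * (q * a / e)) = z4 at *
  have fin : ∀ U V W : ℂ, (X1 - X0) * U * V * (W * z1) = (X1 - X0) * (U * V * W) * z1 := by
    intros; ring
  rw [fin] at key
  generalize -a * (q ^ (k + 1) * q ^ i) / (1 - q ^ (k + 1)) *
      ((1 - q ^ nb * b * (q ^ nc * c) / a) * (1 - q ^ nb * b * (q ^ nd * d) / a) *
      (1 - q ^ nb * b * (q ^ ne * e) / a)) * (1 - q ^ i * (q ^ nb * b)) = U at *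
  generalize q ^ (k + 1) * ((1 - q ^ i * (q ^ nb * b)) * (1 - q ^ i * (q ^ nc * c)) *
        (1 - q ^ i * (q ^ nd * d)) * (1 - q ^ i * (q ^ ne * e))) = V at *
  generalize (1 + (q ^ nb * b) ^ 2 / a - q ^ nb * b * X1) = l1 at *
  generalize (1 + (q ^ nb * b) ^ 2 / a - q ^ nb * b * X0) = l0 at *
  clear_value C0
  field_simp
  linear_combination C0 * key

/-- The table is symmetric in the pairs (parameter, index); this and the next two swaps carry the
step in direction b to the other directions. -/
theorem ddTable_swap_bc (q a b c d e : ℂ) (nb nc nd ne i : ℕ) :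
    ddTable q a b c d e nb nc nd ne i = ddTable q a c b d e nc nb nd ne i := by
  simp only [ddTable, add_comm, add_left_comm, mul_comm c b]
  ring

theorem ddTable_swap_bd (q a b c d e : ℂ) (nb nc nd ne i : ℕ) :
    ddTable q a b c d e nb nc nd ne i = ddTable q a d c b e nd nc nb ne i := by
  simp only [ddTable, add_comm, add_left_comm, mul_comm d b, mul_comm d c, mul_comm c b]
  ring

theorem ddTable_swap_be (q a b c d e : ℂ) (nb nc nd ne i : ℕ) :
    ddTable q a b c d e nb nc nd ne i = ddTable q a e c d b ne nc nd nb i := by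
  simp only [ddTable, add_comm, add_left_comm, mul_comm e b, mul_comm e c, mul_comm e d,
    mul_comm d b, mul_comm c b]
  ring

theorem qPoch_ne_zero {x q : ℂ} (h : ∀ n, 1 - q ^ n * x ≠ 0) (n : ℕ) : qPoch x q n ≠ 0 :=
  prod_ne_zero_iff.2 fun i _ => h i

theorem one_sub_ne_zero_of_qPochInf_ne_zero {x q : ℂ} (h : qPochInf x q ≠ 0) (n : ℕ) :
    1 - q ^ n * x ≠ 0 := fun h0 => h (tprod_of_exists_eq_zero ⟨n, h0⟩)

theorem continuous_qPoch (q : ℂ) (n : ℕ) : Continuous fun x => qPoch x q n := by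
  unfold qPoch
  fun_prop

/-! ### Expansions along lattice paths -/

/-- `ddTable` for vectors of parameters. -/
def ddTableVec (q a : ℂ) (z : Fin 4 → ℂ) (N : Fin 4 → ℕ) (i : ℕ) : ℂ :=
  ddTable q a (z 0) (z 1) (z 2) (z 3) (N 0) (N 1) (N 2) (N 3) i

/-- The quotient `φ(q ^ n; k + 1) / φ(q ^ n; k)`, for a step in the direction of the
parameter `y` at height `j`. -/
def stepFactor (q a y : ℂ) (j n : ℕ) : ℂ :=
  1 + (q ^ j * y) ^ 2 / a - q ^ j * y * node q a n

theorem ddTableVec_step {q a : ℂ} {z : Fin 4 → ℂ} (hq : q ≠ 0) (ha : a ≠ 0) (hz : ∀ p, z p ≠ 0)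
    (h : z 0 * z 1 * z 2 * z 3 = q * a ^ 2) (hqq : ∀ n, qPoch q q n ≠ 0)
    (hD : ∀ p n, qPoch (q * a / z p) q n ≠ 0) (N : Fin 4 → ℕ) (p : Fin 4) (k i : ℕ)
    (hk : ∑ p, N p = k) :
    (node q a (i + k + 1) - node q a i) * ddTableVec q a z (N + Pi.single p 1) i =
      stepFactor q a (z p) (N p) (i + k + 1) * ddTableVec q a z N (i + 1) -
        stepFactor q a (z p) (N p) i * ddTableVec q a z N i := by
  rw [Fin.sum_univ_four] at hk
  unfold ddTableVec stepFactor
  fin_cases p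
  · have := ddTable_step hq ha (hz 0) (hz 1) (hz 2) (hz 3) h hqq (hD 0) (hD 1) (hD 2) (hD 3)
      (N 0) (N 1) (N 2) (N 3) i
    rw [hk] at this
    simpa using this
  · have := ddTable_step hq ha (hz 1) (hz 0) (hz 2) (hz 3) (by linear_combination h) hqq
      (hD 1) (hD 0) (hD 2) (hD 3) (N 1) (N 0) (N 2) (N 3) i
    rw [show N 1 + N 0 + N 2 + N 3 = k by omega] at this
    simp only [ddTable_swap_bc q a (z 0)]
    simpa using this
  · have := ddTable_step hq ha (hz 2) (hz 1) (hz 0) (hz 3) (by linear_combination h) hqq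
      (hD 2) (hD 1) (hD 0) (hD 3) (N 2) (N 1) (N 0) (N 3) i
    rw [show N 2 + N 1 + N 0 + N 3 = k by omega] at this
    simp only [ddTable_swap_bd q a (z 0)]
    simpa using this
  · have := ddTable_step hq ha (hz 3) (hz 1) (hz 2) (hz 0) (by linear_combination h) hqq
      (hD 3) (hD 1) (hD 2) (hD 0) (N 3) (N 1) (N 2) (N 0) i
    rw [show N 3 + N 1 + N 2 + N 0 = k by omega] at this
    simp only [ddTable_swap_be q a (z 0)]
    simpa using this

/-- A lattice path from the origin, whose `k`-th step is in direction `κ k`. -/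
structure IsPath (κ : ℕ → Fin 4) (N : ℕ → Fin 4 → ℕ) : Prop where
  zero : N 0 = 0
  succ : ∀ k, N (k + 1) = N k + Pi.single (κ k) 1

theorem IsPath.sum_eq {κ : ℕ → Fin 4} {N : ℕ → Fin 4 → ℕ} (h : IsPath κ N) (k : ℕ) :
    ∑ p, N k p = k := by
  induction k with
  | zero => simp [h.zero]
  | succ k ih => simp [h.succ, sum_add_distrib, ih]

theorem IsPath.le {κ : ℕ → Fin 4} {N : ℕ → Fin 4 → ℕ} (h : IsPath κ N) (k : ℕ) (p : Fin 4) :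
    N k p ≤ k := by
  conv_rhs => rw [← h.sum_eq k]
  exact single_le_sum (f := N k) (fun _ _ => Nat.zero_le _) (mem_univ p)

theorem path_expansion_of_injective {κ : ℕ → Fin 4} {N : ℕ → Fin 4 → ℕ} (hN : IsPath κ N)
    {q a : ℂ} {z : Fin 4 → ℂ} (hq : q ≠ 0) (ha : a ≠ 0) (hz : ∀ p, z p ≠ 0)
    (h : z 0 * z 1 * z 2 * z 3 = q * a ^ 2) (hqq : ∀ n, qPoch q q n ≠ 0)
    (hD : ∀ p n, qPoch (q * a / z p) q n ≠ 0) (hX : Function.Injective (node q a)) (n : ℕ) :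
    ddTableVec q a z 0 n * ∏ m ∈ range n, stepFactor q a (z (κ m)) (N m (κ m)) n =
      ∑ k ∈ range n, stepFactor q a (z (κ k)) (N k (κ k)) k * ddTableVec q a z (N k) 0 *
          (∏ j ∈ range k, (node q a n - node q a j)) *
          ∏ m ∈ Ico (k + 1) n, stepFactor q a (z (κ m)) (N m (κ m)) n +
        ddTableVec q a z (N n) 0 * ∏ j ∈ range n, (node q a n - node q a j) := by
  have key := newton_expansion hX (fun k => 1 + (q ^ N k (κ k) * z (κ k)) ^ 2 / a)
    (fun k => -(q ^ N k (κ k) * z (κ k))) (fun k i => ddTableVec q a z (N k) i) (by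
      intro k i
      have := ddTableVec_step hq ha hz h hqq hD (N k) (κ k) k i (hN.sum_eq k)
      rw [← hN.succ] at this
      simp only [stepFactor] at this
      linear_combination this) n
  simp only [hN.zero] at key
  simpa only [stepFactor, sub_eq_add_neg, neg_mul] using key

/-! ### Coinciding nodes: continuity in a -/

/-- The parameters `b, c, d` and `e = q a² / (b c d)`. -/
def params (q b c d a : ℂ) : Fin 4 → ℂ := ![b, c, d, q * a ^ 2 / (b * c * d)]

theorem params_ne_zero {q b c d a : ℂ} (hq : q ≠ 0) (hb : b ≠ 0) (hc : c ≠ 0) (hd : d ≠ 0)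
    (ha : a ≠ 0) (p : Fin 4) : params q b c d a p ≠ 0 := by
  fin_cases p <;> simp [params, *]

theorem params_prod {q b c d a : ℂ} (hb : b ≠ 0) (hc : c ≠ 0) (hd : d ≠ 0) :
    params q b c d a 0 * params q b c d a 1 * params q b c d a 2 * params q b c d a 3 =
      q * a ^ 2 := by
  simp [params]
  field_simp

theorem continuousAt_params {q b c d a : ℂ} (p : Fin 4) :
    ContinuousAt (fun a => params q b c d a p) a := by
  fin_cases p <;> simp [params] <;> fun_prop

theorem pow_injective_of_norm_lt_one {q : ℂ} (hq : q ≠ 0) (hq1 : ‖q‖ < 1) :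
    Function.Injective fun n : ℕ => q ^ n := by
  intro m n hmn
  have := congrArg norm hmn
  simp only [norm_pow] at this
  exact pow_right_injective₀ (norm_pos_iff.2 hq) hq1.ne this

/-- The difference of nodes m and n factors as (q^m - q^n)(1 - 1/(a q^(m+n))). -/
theorem injective_node {q a : ℂ} (hq : q ≠ 0) (hq1 : ‖q‖ < 1) (ha : a ≠ 0)
    (h : ∀ n, a * q ^ n ≠ 1) : Function.Injective (node q a) := by
  intro m n hmn
  apply pow_injective_of_norm_lt_one hq hq1
  have h1 : (q ^ m - q ^ n) * (a * q ^ (m + n) - 1) = 0 := by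
    have : node q a m - node q a n = 0 := sub_eq_zero.2 hmn
    unfold node at this
    field_simp at this
    rw [pow_add]
    linear_combination this
  rcases mul_eq_zero.1 h1 with h2 | h2
  · exact sub_eq_zero.1 h2
  · exact absurd (sub_eq_zero.1 h2) (h _)

theorem qPoch_self_ne_zero {q : ℂ} (hq1 : ‖q‖ < 1) (n : ℕ) : qPoch q q n ≠ 0 := by
  refine qPoch_ne_zero (fun i h0 => ?_) n
  have : ‖q ^ i * q‖ = 1 := by rw [← sub_eq_zero.1 h0, norm_one]
  rw [← pow_succ, norm_pow] at this
  exact (pow_lt_one₀ (norm_nonneg q) hq1 (by omega)).ne this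

/-- Each condition excludes only countably many `a`, and a countable set has dense complement in ℂ.
-/
theorem dense_generic {q b c d : ℂ} (hq : q ≠ 0) (hq1 : ‖q‖ < 1) (hb : b ≠ 0) (hc : c ≠ 0)
    (hd : d ≠ 0) :
    Dense {a : ℂ | a ≠ 0 ∧ Function.Injective (node q a) ∧
      ∀ p n, qPoch (q * a / params q b c d a p) q n ≠ 0} := by
  have hc' : Set.Countable ({0} ∪ Set.range (fun n : ℕ => 1 / q ^ n) ∪
      Set.range (fun n : ℕ => b / q ^ (n + 1)) ∪ Set.range (fun n : ℕ => c / q ^ (n + 1)) ∪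
      Set.range (fun n : ℕ => d / q ^ (n + 1)) ∪
      Set.range (fun n : ℕ => q ^ n * (b * c * d))) := by
    simp only [Set.countable_union, Set.countable_range, Set.countable_singleton, and_true]
  refine (hc'.dense_compl ℂ).mono ?_
  intro a ha
  simp only [Set.mem_compl_iff, Set.mem_union, Set.mem_singleton_iff, Set.mem_range, not_or,
    not_exists] at ha
  obtain ⟨⟨⟨⟨⟨h0, h1⟩, h2⟩, h3⟩, h4⟩, h5⟩ := ha
  refine ⟨h0, injective_node hq hq1 h0 fun n hn => h1 n ?_, fun p => qPoch_ne_zero fun n hn => ?_⟩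
  · field_simp
    rw [mul_comm]
    exact hn.symm
  · have h6 : ∀ {y}, y ≠ 0 → 1 - q ^ n * (q * a / y) = 0 → y / q ^ (n + 1) = a := by
      intro y hy h
      field_simp at h ⊢
      linear_combination h
    fin_cases p
    · exact h2 n (h6 hb hn)
    · exact h3 n (h6 hc hn)
    · exact h4 n (h6 hd hn)
    · apply h5 n
      simp [params] at hn
      field_simp at hn
      linear_combination -hn

theorem continuousAt_node {q a : ℂ} (hq : q ≠ 0) (ha : a ≠ 0) (n : ℕ) :
    ContinuousAt (fun a => node q a n) a := by
  unfold node
  have : a * q ^ n ≠ 0 := by simp [hq, ha]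
  fun_prop (disch := assumption)

theorem continuousAt_ddTableVec {q b c d a : ℂ} (hq : q ≠ 0) (hb : b ≠ 0) (hc : c ≠ 0)
    (hd : d ≠ 0) (ha : a ≠ 0) (hqq : ∀ n, qPoch q q n ≠ 0)
    (hD : ∀ p n, qPoch (q * a / params q b c d a p) q n ≠ 0) (N : Fin 4 → ℕ) (i : ℕ) :
    ContinuousAt (fun a => ddTableVec q a (params q b c d a) N i) a := by
  have hp := fun p => continuousAt_params (q := q) (b := b) (c := c) (d := d) (a := a) p
  have hid : ContinuousAt (fun a : ℂ => a) a := continuousAt_id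
  have h1 : ∀ p r n, ContinuousAt
      (fun a => qPoch (params q b c d a p * params q b c d a r / a) q n) a := fun p r n =>
    (continuous_qPoch q n).continuousAt.comp (((hp p).mul (hp r)).div hid ha)
  have h2 : ∀ p n, ContinuousAt (fun a => qPoch (params q b c d a p) q n) a := fun p n =>
    (continuous_qPoch q n).continuousAt.comp (hp p)
  have h3 : ∀ p n, ContinuousAt (fun a => qPoch (q * a / params q b c d a p) q n) a := fun p n =>
    (continuous_qPoch q n).continuousAt.comp
      ((continuousAt_const.mul hid).div (hp p) (params_ne_zero hq hb hc hd ha p))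
  unfold ddTableVec ddTable
  refine ContinuousAt.div (ContinuousAt.mul (ContinuousAt.mul (ContinuousAt.div
    (ContinuousAt.mul (ContinuousAt.pow hid.neg _) continuousAt_const) continuousAt_const
    (hqq _)) ?_) ?_) ?_ ?_
  · exact (((((h1 _ _ _).mul (h1 _ _ _)).mul (h1 _ _ _)).mul (h1 _ _ _)).mul (h1 _ _ _)).mul
      (h1 _ _ _)
  · exact (((h2 _ _).mul (h2 _ _)).mul (h2 _ _)).mul (h2 _ _)
  · exact (((h3 _ _).mul (h3 _ _)).mul (h3 _ _)).mul (h3 _ _)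
  · simp only [ne_eq, mul_eq_zero, hD, or_self, not_false_eq_true]

/-- Here b, c, d and the path are fixed while e = qa²/(bcd) moves with `a`. The closed form has no
node differences in its denominators, so both sides are continuous at `a` even when nodes collide
there, and they agree at generic points arbitrarily close to it. -/
theorem path_expansion {κ : ℕ → Fin 4} {N : ℕ → Fin 4 → ℕ} (hN : IsPath κ N)
    {q a b c d : ℂ} (hq : q ≠ 0) (hq1 : ‖q‖ < 1) (hb : b ≠ 0) (hc : c ≠ 0) (hd : d ≠ 0)
    (ha : a ≠ 0) (hD : ∀ p n, qPoch (q * a / params q b c d a p) q n ≠ 0) (n : ℕ) :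
    ddTableVec q a (params q b c d a) 0 n *
        ∏ m ∈ range n, stepFactor q a (params q b c d a (κ m)) (N m (κ m)) n =
      ∑ k ∈ range n, stepFactor q a (params q b c d a (κ k)) (N k (κ k)) k *
          ddTableVec q a (params q b c d a) (N k) 0 *
          (∏ j ∈ range k, (node q a n - node q a j)) *
          ∏ m ∈ Ico (k + 1) n, stepFactor q a (params q b c d a (κ m)) (N m (κ m)) n +
        ddTableVec q a (params q b c d a) (N n) 0 *
          ∏ j ∈ range n, (node q a n - node q a j) := by
  have hqq := qPoch_self_ne_zero hq1
  have hT := continuousAt_ddTableVec hq hb hc hd ha hqq hD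
  have hnode := continuousAt_node hq ha
  have hS : ∀ p j n, ContinuousAt (fun a => stepFactor q a (params q b c d a p) j n) a := by
    intro p j n
    have h1 := continuousAt_params (q := q) (b := b) (c := c) (d := d) (a := a) p
    have h2 := hnode n
    unfold stepFactor
    fun_prop (disch := assumption)
  have hP : ∀ k, ContinuousAt (fun a => ∏ j ∈ range k, (node q a n - node q a j)) a := fun k =>
    tendsto_finsetProd _ fun j _ => (hnode n).sub (hnode j)
  have hQ : ∀ s : Finset ℕ, ContinuousAt (fun a =>
      ∏ m ∈ s, stepFactor q a (params q b c d a (κ m)) (N m (κ m)) n) a := fun s =>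
    tendsto_finsetProd _ fun j _ => hS _ _ _
  refine tendsto_nhds_unique_of_frequently_eq ((hT 0 n).mul (hQ (range n)))
    (ContinuousAt.add (tendsto_finsetSum _ fun k _ =>
      (((hS (κ k) (N k (κ k)) k).mul (hT (N k) 0)).mul (hP k)).mul (hQ (Ico (k + 1) n)))
      ((hT (N n) 0).mul (hP n))) ?_
  have hfr := mem_closure_iff_frequently.1 (dense_generic hq hq1 hb hc hd a)
  refine hfr.mono fun a' ⟨h0, hX, hD'⟩ => ?_
  exact path_expansion_of_injective hN hq h0 (params_ne_zero hq hb hc hd h0)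
    (params_prod hb hc hd) hqq hD' hX n

/-! ### Normalisation and the finite identity -/

/-- `stepFactor`, normalised to tend to `1`. -/
def stepUnit (q a y : ℂ) (j n : ℕ) : ℂ := (1 - q ^ j * q ^ n * y) * (1 - q ^ n / q ^ j * (a / y))

/-- The differences of nodes, normalised to tend to `1`. -/
def nodeUnit (q a : ℂ) (n j : ℕ) : ℂ := (1 - q ^ n / q ^ j) * (1 - a * q ^ n * q ^ j)

theorem stepFactor_eq {q a y : ℂ} (hq : q ≠ 0) (ha : a ≠ 0) (hy : y ≠ 0) (j n : ℕ) :
    stepFactor q a y j n = -(q ^ j * y / (a * q ^ n)) * stepUnit q a y j n := by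
  unfold stepFactor stepUnit node
  field_simp
  ring

theorem node_sub_node {q a : ℂ} (hq : q ≠ 0) (ha : a ≠ 0) (n j : ℕ) :
    node q a n - node q a j = 1 / (a * q ^ n) * nodeUnit q a n j := by
  unfold nodeUnit node
  field_simp
  ring

/-- The part of `ddTableVec q a z N 0` that does not grow. -/
def ddQuot (q a : ℂ) (z : Fin 4 → ℂ) (N : Fin 4 → ℕ) : ℂ :=
  (qPoch (z 0 * z 1 / a) q (N 0 + N 1) * qPoch (z 0 * z 2 / a) q (N 0 + N 2) *
      qPoch (z 0 * z 3 / a) q (N 0 + N 3) * qPoch (z 1 * z 2 / a) q (N 1 + N 2) *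
      qPoch (z 1 * z 3 / a) q (N 1 + N 3) * qPoch (z 2 * z 3 / a) q (N 2 + N 3)) *
    (qPoch (z 0) q (N 0) * qPoch (z 1) q (N 1) * qPoch (z 2) q (N 2) * qPoch (z 3) q (N 3)) /
    (qPoch q q (N 0 + N 1 + N 2 + N 3) *
      (qPoch (q * a / z 0) q (N 1 + N 2 + N 3) * qPoch (q * a / z 1) q (N 0 + N 2 + N 3) *
      qPoch (q * a / z 2) q (N 0 + N 1 + N 3) * qPoch (q * a / z 3) q (N 0 + N 1 + N 2)))

/-- The partial products of the product side. -/
def prodSide (q a : ℂ) (z : Fin 4 → ℂ) (n : ℕ) : ℂ :=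
  (qPoch (z 0) q n * qPoch (z 1) q n * qPoch (z 2) q n * qPoch (z 3) q n) /
    (qPoch (q * a / z 0) q n * qPoch (q * a / z 1) q n * qPoch (q * a / z 2) q n *
      qPoch (q * a / z 3) q n)

theorem ddTableVec_zero_right (q a : ℂ) (z : Fin 4 → ℂ) {N : Fin 4 → ℕ} {k : ℕ}
    (hk : ∑ p, N p = k) :
    ddTableVec q a z N 0 = (-a) ^ k * q ^ (k + 1).choose 2 * ddQuot q a z N := by
  rw [Fin.sum_univ_four] at hk
  simp only [ddTableVec, ddTable, ddQuot, hk, zero_add, zero_mul, add_zero]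
  simp only [div_eq_mul_inv _ (_ * _), div_eq_mul_inv _ (qPoch _ _ _), mul_inv]
  ring

theorem ddTableVec_zero_left (q a : ℂ) (z : Fin 4 → ℂ) (n : ℕ) :
    ddTableVec q a z 0 n = q ^ n * prodSide q a z n := by
  simp [ddTableVec, ddTable, prodSide, qPoch_zero]
  ring

/-- The finite form of the series identity. -/
theorem prodSide_eq_sum {κ : ℕ → Fin 4} {N : ℕ → Fin 4 → ℕ} (hN : IsPath κ N)
    {q a b c d : ℂ} (hq : q ≠ 0) (hq1 : ‖q‖ < 1) (hb : b ≠ 0) (hc : c ≠ 0) (hd : d ≠ 0)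
    (ha : a ≠ 0) {z : Fin 4 → ℂ} (hz : z = params q b c d a)
    (hD : ∀ p n, qPoch (q * a / z p) q n ≠ 0) {θ : ℕ → ℂ} (hθ0 : θ 0 = 1)
    (hθ : ∀ k, θ (k + 1) = θ k * (q ^ k / q ^ N k (κ k) * (a / z (κ k)))) {n : ℕ}
    (hu : ∀ j < n, stepUnit q a (z (κ j)) (N j (κ j)) n ≠ 0) :
    prodSide q a z n =
      ∑ k ∈ range n, θ k * ddQuot q a z (N k) * stepUnit q a (z (κ k)) (N k (κ k)) k *
          ((∏ j ∈ range k, nodeUnit q a n j) /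
            ∏ j ∈ range (k + 1), stepUnit q a (z (κ j)) (N j (κ j)) n) +
        θ n * ddQuot q a z (N n) * ((∏ j ∈ range n, nodeUnit q a n j) /
            ∏ j ∈ range n, stepUnit q a (z (κ j)) (N j (κ j)) n) := by
  have hz0 : ∀ p, z p ≠ 0 := fun p => by rw [hz]; exact params_ne_zero hq hb hc hd ha p
  have key := path_expansion hN hq hq1 hb hc hd ha (by rw [← hz]; exact hD) n
  simp only [← hz] at key
  set u : ℕ → ℕ → ℂ := fun k m => stepUnit q a (z (κ k)) (N k (κ k)) m with hu_def
  set L : ℕ → ℕ → ℂ := fun k m => stepFactor q a (z (κ k)) (N k (κ k)) m with hL_def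
  have hL : ∀ k m, L k m = -(q ^ N k (κ k) * z (κ k) / (a * q ^ m)) * u k m := fun k m =>
    stepFactor_eq hq ha (hz0 _) _ _
  have hLne : ∀ j < n, L j n ≠ 0 := by
    intro j hj
    rw [hL]
    exact mul_ne_zero (neg_ne_zero.2 (div_ne_zero (mul_ne_zero (pow_ne_zero _ hq) (hz0 _))
      (mul_ne_zero ha (pow_ne_zero _ hq)))) (hu j hj)
  -- Node differences and step factors both grow like q^(-n). In the quotient these powers cancel,
  -- and the remaining monomial is q^k θ(k).
  have hW : ∀ k ≤ n, (-a) ^ k * q ^ (k + 1).choose 2 *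
      ((∏ j ∈ range k, (node q a n - node q a j)) / ∏ j ∈ range k, L j n) =
      q ^ k * θ k * ((∏ j ∈ range k, nodeUnit q a n j) / ∏ j ∈ range k, u j n) := by
    intro k
    induction k with
    | zero => simp [hθ0]
    | succ k ih =>
      intro hk
      have h1 := ih (by omega)
      have h2 : (k + 1 + 1).choose 2 = (k + 1).choose 2 + (k + 1) := by
        rw [Nat.choose_succ_succ' (k + 1) 1, Nat.choose_one_right]; ring
      have h3 : -a * q ^ (k + 1) * ((node q a n - node q a k) / L k n) =
          q * (q ^ k / q ^ N k (κ k) * (a / z (κ k))) * (nodeUnit q a n k / u k n) := by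
        have hk0 : u k n ≠ 0 := hu k (by omega)
        have := hz0 (κ k)
        rw [hL, node_sub_node hq ha]
        field_simp
        ring
      rw [prod_range_succ, prod_range_succ, prod_range_succ, prod_range_succ, hθ, h2, pow_add,
        pow_succ (-a), mul_div_mul_comm, mul_div_mul_comm]
      calc _ = ((-a) ^ k * q ^ (k + 1).choose 2 *
            ((∏ j ∈ range k, (node q a n - node q a j)) / ∏ j ∈ range k, L j n)) *
            (-a * q ^ (k + 1) * ((node q a n - node q a k) / L k n)) := by ring
        _ = _ := by rw [h1, h3]; ring
  have hprod : ∏ m ∈ range n, L m n ≠ 0 := prod_ne_zero_iff.2 fun j hj => hLne j (mem_range.1 hj)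
  change _ * ∏ m ∈ range n, L m n = ∑ k ∈ range n, L k k * _ * _ * ∏ m ∈ Ico (k + 1) n, L m n + _
    at key
  rw [ddTableVec_zero_left, ddTableVec_zero_right q a z (hN.sum_eq n)] at key
  have key2 := eq_div_of_mul_eq hprod key
  rw [add_div, sum_div] at key2
  have hqn : q ^ n ≠ 0 := pow_ne_zero _ hq
  apply mul_left_cancel₀ hqn
  rw [key2, mul_add, mul_sum]
  congr 1
  · refine sum_congr rfl fun k hk => ?_
    have hkn := mem_range.1 hk
    have h1 : ∏ m ∈ range n, L m n =
        (∏ m ∈ range k, L m n) * L k n * ∏ m ∈ Ico (k + 1) n, L m n := by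
      rw [← prod_range_succ, prod_range_mul_prod_Ico _ (by omega)]
    have h2 : ∏ m ∈ Ico (k + 1) n, L m n ≠ 0 :=
      prod_ne_zero_iff.2 fun j hj => hLne j (mem_Ico.1 hj).2
    -- This turns q^k into the factor q^n that accompanies `prodSide`.
    have h3 : L k k / L k n * q ^ k = q ^ n * (u k k / u k n) := by
      have h4 : u k n ≠ 0 := hu k hkn
      have := hz0 (κ k)
      rw [hL, hL]
      field_simp
    rw [h1, ddTableVec_zero_right q a z (hN.sum_eq k), mul_div_mul_right _ _ h2,
      prod_range_succ]
    calc _ = (L k k / L k n) * ddQuot q a z (N k) * ((-a) ^ k * q ^ (k + 1).choose 2 *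
      ((∏ j ∈ range k, (node q a n - node q a j)) / ∏ j ∈ range k, L j n)) := by
          simp only [div_eq_mul_inv, mul_inv]; ring
      _ = (L k k / L k n * q ^ k) * (θ k * ddQuot q a z (N k) *
        ((∏ j ∈ range k, nodeUnit q a n j) / ∏ j ∈ range k, u j n)) := by
          rw [hW k hkn.le]; ring
      _ = _ := by
          rw [h3]; simp only [div_eq_mul_inv, mul_inv]; ring
  · calc _ = ddQuot q a z (N n) * ((-a) ^ n * q ^ (n + 1).choose 2 *
      ((∏ j ∈ range n, (node q a n - node q a j)) / ∏ j ∈ range n, L j n)) := by ring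
      _ = _ := by rw [hW n le_rfl]; ring

/-! ### Bounds uniform in n -/

theorem exists_norm_prod_one_add_le {w : ℕ → ℂ} (hw : Summable fun i => ‖w i‖) :
    ∃ C, ∀ S : Finset ℕ, ‖∏ i ∈ S, (1 + w i)‖ ≤ C := by
  refine ⟨Real.exp (∑' i, ‖w i‖), fun S => ?_⟩
  calc ‖∏ i ∈ S, (1 + w i)‖ = ∏ i ∈ S, ‖1 + w i‖ := norm_prod _ _
    _ ≤ ∏ i ∈ S, Real.exp ‖w i‖ := prod_le_prod (fun _ _ => norm_nonneg _) fun i _ =>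
        (norm_add_le _ _).trans (by rw [norm_one, add_comm]; exact Real.add_one_le_exp _)
    _ = Real.exp (∑ i ∈ S, ‖w i‖) := (Real.exp_sum _ _).symm
    _ ≤ _ := Real.exp_le_exp.2 (hw.sum_le_tsum S fun _ _ => norm_nonneg _)

theorem summable_norm_pow_mul {q : ℂ} (hq1 : ‖q‖ < 1) (x : ℂ) :
    Summable fun i : ℕ => ‖q ^ i * x‖ := by
  simp only [norm_mul, norm_pow]
  exact (summable_geometric_of_lt_one (norm_nonneg q) hq1).mul_right _

theorem tendsto_pow_mul_zero {q : ℂ} (hq1 : ‖q‖ < 1) (x : ℂ) :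
    Filter.Tendsto (fun i : ℕ => q ^ i * x) Filter.atTop (nhds 0) := by
  simpa using (tendsto_pow_atTop_nhds_zero_of_norm_lt_one hq1).mul_const x

theorem exists_norm_prod_le {q : ℂ} (hq1 : ‖q‖ < 1) (x : ℂ) :
    ∃ C, ∀ S : Finset ℕ, ‖∏ i ∈ S, (1 - q ^ i * x)‖ ≤ C := by
  obtain ⟨C, hC⟩ := exists_norm_prod_one_add_le (w := fun i => -(q ^ i * x))
    (by simpa using summable_norm_pow_mul hq1 x)
  exact ⟨C, by simpa [sub_eq_add_neg] using hC⟩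

/-- Finite subproducts of `(x; q)_∞`, stripped of any vanishing one, are bounded away from `0`. -/
theorem exists_norm_prod_inv_le {q : ℂ} (hq1 : ‖q‖ < 1) (x : ℂ) :
    ∃ C, ∀ S : Finset ℕ, ‖(∏ i ∈ S, (1 - q ^ i * x))⁻¹‖ ≤ C := by
  -- Since 1/(1 - w) = 1 + w/(1 - w), the bound for products of 1 + wᵢ applies. A vanishing 1 - w is
  -- harmless because division by zero gives 0.
  have hsum : Summable fun i : ℕ => ‖q ^ i * x / (1 - q ^ i * x)‖ := by
    refine Summable.of_norm_bounded_eventually_nat (g := fun i => ‖q ^ i * x‖ * 2)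
      ((summable_norm_pow_mul hq1 x).mul_right _) ?_
    have h := (tendsto_pow_mul_zero hq1 x).norm
    rw [norm_zero] at h
    filter_upwards [h.eventually_lt_const (show (0 : ℝ) < 1 / 2 by norm_num)] with i hi
    have h1 : 1 / 2 ≤ ‖1 - q ^ i * x‖ := by
      have := norm_sub_norm_le (1 : ℂ) (q ^ i * x)
      rw [norm_one] at this
      linarith
    rw [norm_norm, norm_div, div_le_iff₀ (by linarith)]
    nlinarith [norm_nonneg (q ^ i * x)]
  obtain ⟨C, hC⟩ := exists_norm_prod_one_add_le hsum
  refine ⟨C, fun S => ?_⟩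
  by_cases h : ∀ i ∈ S, 1 - q ^ i * x ≠ 0
  · refine le_of_eq_of_le ?_ (hC S)
    rw [← prod_inv_distrib]
    congr 1
    refine prod_congr rfl fun i hi => ?_
    have := h i hi
    rw [eq_comm, inv_eq_one_div, eq_div_iff this, add_mul, div_mul_cancel₀ _ this]
    ring
  · push Not at h
    obtain ⟨i, hi, h0⟩ := h
    rw [prod_eq_zero hi h0, inv_zero, norm_zero]
    exact (norm_nonneg _).trans (hC ∅)

/-- In each direction `p`, the first `k` steps start exactly once from each of the heights 0, …, `N
k p` - 1. -/
theorem prod_path {M : Type*} [CommMonoid M] {κ : ℕ → Fin 4} {N : ℕ → Fin 4 → ℕ}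
    (hN : IsPath κ N) (f : Fin 4 → ℕ → M) (k : ℕ) :
    ∏ j ∈ range k, f (κ j) (N j (κ j)) = ∏ p, ∏ i ∈ range (N k p), f p i := by
  induction k with
  | zero => simp [hN.zero]
  | succ k ih =>
    have h : ∀ p, ∏ i ∈ range (N (k + 1) p), f p i =
        (∏ i ∈ range (N k p), f p i) * if p = κ k then f p (N k p) else 1 := by
      intro p
      rw [hN.succ]
      by_cases hp : p = κ k
      · subst hp
        simp [prod_range_succ]
      · simp [hp]
    rw [prod_range_succ, ih, prod_congr rfl fun p _ => h p, prod_mul_distrib, prod_ite_eq']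
    simp

theorem exists_norm_mul_le {ι : Type*} {f g : ι → ℂ} (hf : ∃ C, ∀ i, ‖f i‖ ≤ C)
    (hg : ∃ C, ∀ i, ‖g i‖ ≤ C) : ∃ C, ∀ i, ‖f i * g i‖ ≤ C := by
  obtain ⟨C, hC⟩ := hf
  obtain ⟨D, hD⟩ := hg
  refine ⟨C * D, fun i => ?_⟩
  rw [norm_mul]
  exact mul_le_mul (hC i) (hD i) (norm_nonneg _) ((norm_nonneg _).trans (hC i))

theorem exists_norm_qPoch_le {ι : Type*} {q : ℂ} (hq1 : ‖q‖ < 1) (x : ℂ) (f : ι → ℕ) :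
    ∃ C, ∀ i, ‖qPoch x q (f i)‖ ≤ C := by
  obtain ⟨C, hC⟩ := exists_norm_prod_le hq1 x
  exact ⟨C, fun i => hC _⟩

theorem exists_norm_qPoch_inv_le {ι : Type*} {q : ℂ} (hq1 : ‖q‖ < 1) (x : ℂ) (f : ι → ℕ) :
    ∃ C, ∀ i, ‖(qPoch x q (f i))⁻¹‖ ≤ C := by
  obtain ⟨C, hC⟩ := exists_norm_prod_inv_le hq1 x
  exact ⟨C, fun i => hC _⟩

theorem exists_norm_ddQuot_le {q : ℂ} (hq1 : ‖q‖ < 1) (a : ℂ) (z : Fin 4 → ℂ) :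
    ∃ C, ∀ N, ‖ddQuot q a z N‖ ≤ C := by
  have A := fun x f => exists_norm_qPoch_le (ι := Fin 4 → ℕ) hq1 x f
  have B := fun x f => exists_norm_qPoch_inv_le (ι := Fin 4 → ℕ) hq1 x f
  have h := exists_norm_mul_le (exists_norm_mul_le
    (exists_norm_mul_le (exists_norm_mul_le (exists_norm_mul_le (exists_norm_mul_le
      (exists_norm_mul_le (A (z 0 * z 1 / a) fun N => N 0 + N 1)
        (A (z 0 * z 2 / a) fun N => N 0 + N 2)) (A (z 0 * z 3 / a) fun N => N 0 + N 3))
        (A (z 1 * z 2 / a) fun N => N 1 + N 2)) (A (z 1 * z 3 / a) fun N => N 1 + N 3))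
        (A (z 2 * z 3 / a) fun N => N 2 + N 3))
    (exists_norm_mul_le (exists_norm_mul_le (exists_norm_mul_le (A (z 0) fun N => N 0)
      (A (z 1) fun N => N 1)) (A (z 2) fun N => N 2)) (A (z 3) fun N => N 3)))
    (exists_norm_mul_le (B q fun N => N 0 + N 1 + N 2 + N 3)
      (exists_norm_mul_le (exists_norm_mul_le (exists_norm_mul_le
        (B (q * a / z 0) fun N => N 1 + N 2 + N 3) (B (q * a / z 1) fun N => N 0 + N 2 + N 3))
        (B (q * a / z 2) fun N => N 0 + N 1 + N 3)) (B (q * a / z 3) fun N => N 0 + N 1 + N 2)))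
  refine h.imp fun C hC N => ?_
  rw [ddQuot, div_eq_mul_inv]
  simp only [mul_inv]
  exact hC N

/-- Distinct exponents make the product a finite subproduct of (x; q)_∞, for which the bounds over
all finite sets hold; hence no dependence on n. -/
theorem prod_image_pow {q x : ℂ} {g : ℕ → ℂ} {m : ℕ} (f : ℕ → ℕ) (hf : ∀ i < m, g i = q ^ f i)
    (hinj : ∀ i < m, ∀ j < m, f i = f j → i = j) :
    ∏ i ∈ range m, (1 - g i * x) = ∏ i ∈ (range m).image f, (1 - q ^ i * x) := by
  rw [prod_image (fun i hi j hj h => hinj i (by simpa using hi) j (by simpa using hj) h)]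
  exact prod_congr rfl fun i hi => by rw [hf i (mem_range.1 hi)]

theorem pow_div_pow_of_le {q : ℂ} (hq : q ≠ 0) {i n : ℕ} (h : i ≤ n) :
    q ^ n / q ^ i = q ^ (n - i) := by
  rw [div_eq_iff (pow_ne_zero _ hq), ← pow_add, Nat.sub_add_cancel h]

theorem exists_norm_prod_nodeUnit_le {q : ℂ} (hq : q ≠ 0) (hq1 : ‖q‖ < 1) (a : ℂ) :
    ∃ C, ∀ n, ∀ k ≤ n, ‖∏ j ∈ range k, nodeUnit q a n j‖ ≤ C := by
  obtain ⟨C, hC⟩ := exists_norm_prod_le hq1 1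
  obtain ⟨D, hD⟩ := exists_norm_prod_le hq1 a
  refine ⟨C * D, fun n k hk => ?_⟩
  unfold nodeUnit
  rw [prod_mul_distrib, norm_mul]
  have h1 := prod_image_pow (q := q) (x := 1) (g := fun j => q ^ n / q ^ j) (m := k) (n - ·)
    (fun i hi => pow_div_pow_of_le hq (by omega)) (fun i hi j hj h => by omega)
  have h2 := prod_image_pow (q := q) (x := a) (g := fun j => q ^ n * q ^ j) (m := k) (n + ·)
    (fun i hi => (pow_add _ _ _).symm) (fun i hi j hj h => by omega)
  simp only [mul_one] at h1
  rw [h1]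
  rw [prod_congr rfl fun j _ => show 1 - a * q ^ n * q ^ j = 1 - q ^ n * q ^ j * a by ring, h2]
  refine mul_le_mul ?_ (hD _) (norm_nonneg _) ((norm_nonneg _).trans (hC ∅))
  simpa using hC (image (n - ·) (range k))

theorem exists_norm_prod_stepUnit_inv_le {q : ℂ} (hq : q ≠ 0) (hq1 : ‖q‖ < 1) (a y : ℂ) :
    ∃ C, ∀ n, ∀ m ≤ n, ‖(∏ i ∈ range m, stepUnit q a y i n)⁻¹‖ ≤ C := by
  obtain ⟨C, hC⟩ := exists_norm_prod_inv_le hq1 y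
  obtain ⟨D, hD⟩ := exists_norm_prod_inv_le hq1 (a / y)
  refine ⟨C * D, fun n m hm => ?_⟩
  unfold stepUnit
  rw [prod_mul_distrib, mul_inv, norm_mul]
  rw [prod_image_pow (q := q) (x := y) (g := fun j => q ^ j * q ^ n) (m := m) (· + n)
    (fun i hi => (pow_add _ _ _).symm) (fun i hi j hj h => by omega)]
  rw [prod_image_pow (q := q) (x := a / y) (g := fun j => q ^ n / q ^ j) (m := m) (n - ·)
    (fun i hi => pow_div_pow_of_le hq (by omega)) (fun i hi j hj h => by omega)]
  exact mul_le_mul (hC _) (hD _) (norm_nonneg _) ((norm_nonneg _).trans (hC ∅))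

theorem exists_norm_stepUnit_le {q : ℂ} (hq : q ≠ 0) (hq1 : ‖q‖ < 1) (a y : ℂ) :
    ∃ C, ∀ k, ∀ j ≤ k, ‖stepUnit q a y j k‖ ≤ C := by
  obtain ⟨C, hC⟩ := exists_norm_prod_le hq1 y
  obtain ⟨D, hD⟩ := exists_norm_prod_le hq1 (a / y)
  refine ⟨C * D, fun k j hj => ?_⟩
  rw [stepUnit, norm_mul, pow_div_pow_of_le hq hj, ← pow_add]
  exact mul_le_mul (by simpa using hC {j + k}) (by simpa using hD {k - j}) (norm_nonneg _)
    ((norm_nonneg _).trans (hC ∅))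

theorem exists_norm_unit_quotient_le {κ : ℕ → Fin 4} {N : ℕ → Fin 4 → ℕ} (hN : IsPath κ N)
    {q : ℂ} (hq : q ≠ 0) (hq1 : ‖q‖ < 1) (a : ℂ) (z : Fin 4 → ℂ) :
    ∃ C, ∀ n, ∀ k ≤ n, ∀ k' ≤ n, ‖(∏ j ∈ range k, nodeUnit q a n j) /
      ∏ j ∈ range k', stepUnit q a (z (κ j)) (N j (κ j)) n‖ ≤ C := by
  obtain ⟨C, hC⟩ := exists_norm_prod_nodeUnit_le hq hq1 a
  choose D hD using fun p => exists_norm_prod_stepUnit_inv_le hq hq1 a (z p)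
  refine ⟨C * ∏ p, D p, fun n k hk k' hk' => ?_⟩
  rw [div_eq_mul_inv, norm_mul,
    prod_path hN (fun p i => stepUnit q a (z p) i n), ← prod_inv_distrib, norm_prod univ]
  refine mul_le_mul (hC n k hk) (prod_le_prod (fun _ _ => norm_nonneg _) fun p _ =>
    hD p n _ ((hN.le k' p).trans hk')) (prod_nonneg fun _ _ => norm_nonneg _)
    ((norm_nonneg _).trans (hC n k hk))

/-! ### Passage to the limit -/

theorem tendsto_unit_quotient {κ : ℕ → Fin 4} {N : ℕ → Fin 4 → ℕ} {q : ℂ} (hq1 : ‖q‖ < 1)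
    (a : ℂ) (z : Fin 4 → ℂ) (k k' : ℕ) :
    Filter.Tendsto (fun n => (∏ j ∈ range k, nodeUnit q a n j) /
      ∏ j ∈ range k', stepUnit q a (z (κ j)) (N j (κ j)) n) Filter.atTop (nhds 1) := by
  have hq := tendsto_pow_atTop_nhds_zero_of_norm_lt_one hq1
  have h1 : ∀ j, Filter.Tendsto (fun n => nodeUnit q a n j) Filter.atTop (nhds 1) := by
    intro j
    have hc : Continuous fun X : ℂ => (1 - X / q ^ j) * (1 - a * X * q ^ j) := by fun_prop
    exact (hc.tendsto' 0 1 (by simp)).comp hq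
  have h2 : ∀ y j, Filter.Tendsto (fun n => stepUnit q a y j n) Filter.atTop (nhds 1) := by
    intro y j
    have hc : Continuous fun X : ℂ => (1 - q ^ j * X * y) * (1 - X / q ^ j * (a / y)) := by
      fun_prop
    exact (hc.tendsto' 0 1 (by simp)).comp hq
  simpa [Pi.div_def] using (tendsto_finsetProd (range k) fun j _ => h1 j).div
    (tendsto_finsetProd (range k') fun j _ => h2 (z (κ j)) (N j (κ j))) (by simp)

theorem eventually_stepUnit_ne_zero {κ : ℕ → Fin 4} {N : ℕ → Fin 4 → ℕ} (hN : IsPath κ N)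
    {q a : ℂ} (hq : q ≠ 0) (hq1 : ‖q‖ < 1) {z : Fin 4 → ℂ}
    (hD : ∀ p n, 1 - q ^ n * (q * a / z p) ≠ 0) :
    ∀ᶠ n in Filter.atTop, ∀ j < n, stepUnit q a (z (κ j)) (N j (κ j)) n ≠ 0 := by
  have h1 : ∀ p, ∀ᶠ n : ℕ in Filter.atTop, ∀ m ≥ n, 1 - q ^ m * z p ≠ 0 := by
    intro p
    have h := (tendsto_pow_mul_zero hq1 (z p)).eventually_ne (show (0 : ℂ) ≠ 1 by simp)
    obtain ⟨n0, hn0⟩ := Filter.eventually_atTop.1 h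
    filter_upwards [Filter.eventually_ge_atTop n0] with n hn m hm
    exact sub_ne_zero.2 (hn0 m (by omega)).symm
  filter_upwards [Filter.eventually_all.2 h1] with n hn j hj
  have hle := hN.le j (κ j)
  refine mul_ne_zero ?_ ?_
  · rw [← pow_add]
    exact hn _ _ (by omega)
  -- As `N j (κ j) ≤ j < n`, the exponent n - `N j (κ j)` is at least 1, so this is a factor of
  -- (qa/z; q)_∞.
  · have := hD (κ j) (n - N j (κ j) - 1)
    rw [pow_div_pow_of_le hq (by omega)]
    rwa [mul_div_assoc, ← mul_assoc, ← pow_succ,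
      show n - N j (κ j) - 1 + 1 = n - N j (κ j) by omega] at this

theorem tendsto_qPoch {q : ℂ} (hq1 : ‖q‖ < 1) (x : ℂ) :
    Filter.Tendsto (qPoch x q) Filter.atTop (nhds (qPochInf x q)) :=
  (multipliable_qPochInf x hq1).hasProd.tendsto_prod_nat

/-- The series along a lattice path sums to the product side. -/
theorem hasSum_path {κ : ℕ → Fin 4} {N : ℕ → Fin 4 → ℕ} (hN : IsPath κ N)
    {q a b c d : ℂ} (hq : q ≠ 0) (hq1 : ‖q‖ < 1) (hb : b ≠ 0) (hc : c ≠ 0) (hd : d ≠ 0)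
    (ha : a ≠ 0) {z : Fin 4 → ℂ} (hz : z = params q b c d a)
    (hD : ∀ p, qPochInf (q * a / z p) q ≠ 0) {θ : ℕ → ℂ} (hθ0 : θ 0 = 1)
    (hθ : ∀ k, θ (k + 1) = θ k * (q ^ k / q ^ N k (κ k) * (a / z (κ k))))
    (hsum : Summable fun k => ‖θ k‖) :
    HasSum (fun k => θ k * ddQuot q a z (N k) * stepUnit q a (z (κ k)) (N k (κ k)) k)
      ((qPochInf (z 0) q * qPochInf (z 1) q * qPochInf (z 2) q * qPochInf (z 3) q) /
        (qPochInf (q * a / z 0) q * qPochInf (q * a / z 1) q * qPochInf (q * a / z 2) q *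
          qPochInf (q * a / z 3) q)) := by
  have hD1 := fun p => one_sub_ne_zero_of_qPochInf_ne_zero (hD p)
  obtain ⟨C, hC⟩ := exists_norm_unit_quotient_le hN hq hq1 a z
  obtain ⟨D, hDD⟩ := exists_norm_ddQuot_le hq1 a z
  choose E hE using fun p => exists_norm_stepUnit_le hq hq1 a (z p)
  set t : ℕ → ℂ := fun k => θ k * ddQuot q a z (N k) * stepUnit q a (z (κ k)) (N k (κ k)) k with ht
  set M : ℕ → ℕ → ℕ → ℂ := fun n k k' => (∏ j ∈ range k, nodeUnit q a n j) /
    ∏ j ∈ range k', stepUnit q a (z (κ j)) (N j (κ j)) n with hM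
  have hC0 : 0 ≤ C := (norm_nonneg _).trans (hC 0 0 le_rfl 0 le_rfl)
  have hD0 : 0 ≤ D := (norm_nonneg _).trans (hDD 0)
  have hE0 : ∀ p, 0 ≤ E p := fun p => (norm_nonneg _).trans (hE p 0 0 le_rfl)
  have htle : ∀ k, ‖t k‖ ≤ ‖θ k‖ * (D * ∑ p, E p) := by
    intro k
    rw [ht, norm_mul, norm_mul, mul_assoc]
    have h1 : ‖stepUnit q a (z (κ k)) (N k (κ k)) k‖ ≤ ∑ p, E p :=
      (hE _ _ _ (hN.le k _)).trans (single_le_sum (fun p _ => hE0 p) (mem_univ _))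
    have := hDD (N k)
    gcongr
  have htsum : Summable fun k => ‖t k‖ :=
    Summable.of_nonneg_of_le (fun _ => norm_nonneg _) htle (hsum.mul_right _)
  have hlim : Filter.Tendsto (prodSide q a z) Filter.atTop
      (nhds ((qPochInf (z 0) q * qPochInf (z 1) q * qPochInf (z 2) q * qPochInf (z 3) q) /
        (qPochInf (q * a / z 0) q * qPochInf (q * a / z 1) q * qPochInf (q * a / z 2) q *
          qPochInf (q * a / z 3) q))) := by
    have h := fun x => tendsto_qPoch hq1 x
    exact ((((h _).mul (h _)).mul (h _)).mul (h _)).div ((((h _).mul (h _)).mul (h _)).mul (h _))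
      (by simp [hD])
  have hlast : Filter.Tendsto (fun n => θ n * ddQuot q a z (N n) * M n n n) Filter.atTop
      (nhds 0) := by
    have h0 : Filter.Tendsto (fun n => ‖θ n‖ * (D * C)) Filter.atTop (nhds 0) := by
      simpa using hsum.tendsto_atTop_zero.mul_const (D * C)
    refine squeeze_zero_norm (fun n => ?_) h0
    rw [norm_mul, norm_mul, mul_assoc]
    have h1 := hDD (N n)
    have h2 := hC n n le_rfl n le_rfl
    gcongr
  -- The finite sums are extended by zero to all `k`, so that dominated convergence applies with
  -- bound `‖t k‖ * C`.
  have hdom : Filter.Tendsto (fun n => ∑' k, if k < n then t k * M n k (k + 1) else 0)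
      Filter.atTop (nhds (∑' k, t k)) := by
    refine tendsto_tsum_of_dominated_convergence (bound := fun k => ‖t k‖ * C)
      (htsum.mul_right C) (fun k => ?_) (Filter.Eventually.of_forall fun n k => ?_)
    · have h1 := (tendsto_unit_quotient (κ := κ) (N := N) hq1 a z k (k + 1)).const_mul (t k)
      rw [mul_one] at h1
      refine h1.congr' ?_
      filter_upwards [Filter.eventually_gt_atTop k] with n hn
      rw [if_pos hn]
    · split_ifs with h
      · rw [norm_mul]
        exact mul_le_mul_of_nonneg_left (hC n k h.le (k + 1) h) (norm_nonneg _)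
      · rw [norm_zero]
        positivity
  have heq : ∀ᶠ n in Filter.atTop, prodSide q a z n =
      (∑' k, if k < n then t k * M n k (k + 1) else 0) + θ n * ddQuot q a z (N n) * M n n n := by
    filter_upwards [eventually_stepUnit_ne_zero (κ := κ) (N := N) hN hq hq1 hD1] with n hn
    rw [prodSide_eq_sum hN hq hq1 hb hc hd ha hz (fun p => qPoch_ne_zero (hD1 p)) hθ0 hθ hn]
    rw [tsum_eq_sum (s := range n) fun k hk => if_neg (by simpa using hk)]
    congr 1
    exact sum_congr rfl fun k hk => (if_pos (mem_range.1 hk)).symm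
  have huniq := tendsto_nhds_unique (hlim.congr' heq) (hdom.add hlast)
  rw [huniq, add_zero]
  exact htsum.of_norm.hasSum

/-! ### Persistence of zeros, and grouping into blocks -/

theorem qPoch_ne_zero_of_le {x q : ℂ} {m n : ℕ} (h : ¬qPoch x q n = 0) (hmn : m ≤ n) :
    ¬qPoch x q m = 0 := fun h0 => by
  rw [qPoch, prod_eq_zero_iff] at h0 h
  obtain ⟨i, hi, h0⟩ := h0
  exact h ⟨i, mem_range.2 ((mem_range.1 hi).trans_le hmn), h0⟩

/-- A shifted factorial that vanishes keeps vanishing as its index grows. This covers denominators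
too, since a zero denominator also makes the quotient 0. -/
theorem ddQuot_eq_zero_of_le {q a : ℂ} {z : Fin 4 → ℂ} {N N' : Fin 4 → ℕ} (hN : N ≤ N')
    (h0 : ddQuot q a z N = 0) : ddQuot q a z N' = 0 := by
  contrapose! h0
  rename' h0 => h
  have l0 : N 0 ≤ N' 0 := hN 0
  have l1 : N 1 ≤ N' 1 := hN 1
  have l2 : N 2 ≤ N' 2 := hN 2
  have l3 : N 3 ≤ N' 3 := hN 3
  simp only [ddQuot, ne_eq, div_eq_zero_iff, mul_eq_zero, not_or] at h ⊢
  obtain ⟨⟨⟨⟨⟨⟨⟨h1, h2⟩, h3⟩, h4⟩, h5⟩, h6⟩, ⟨⟨⟨g1, g2⟩, g3⟩, g4⟩⟩,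
    ⟨k0, ⟨⟨⟨k1, k2⟩, k3⟩, k4⟩⟩⟩ := h
  refine ⟨⟨⟨⟨⟨⟨⟨?_, ?_⟩, ?_⟩, ?_⟩, ?_⟩, ?_⟩, ⟨⟨⟨?_, ?_⟩, ?_⟩, ?_⟩⟩,
    ⟨?_, ⟨⟨⟨?_, ?_⟩, ?_⟩, ?_⟩⟩⟩
  exacts [qPoch_ne_zero_of_le h1 (by omega), qPoch_ne_zero_of_le h2 (by omega),
    qPoch_ne_zero_of_le h3 (by omega), qPoch_ne_zero_of_le h4 (by omega),
    qPoch_ne_zero_of_le h5 (by omega), qPoch_ne_zero_of_le h6 (by omega),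
    qPoch_ne_zero_of_le g1 (by omega), qPoch_ne_zero_of_le g2 (by omega),
    qPoch_ne_zero_of_le g3 (by omega), qPoch_ne_zero_of_le g4 (by omega),
    qPoch_ne_zero_of_le k0 (by omega), qPoch_ne_zero_of_le k1 (by omega),
    qPoch_ne_zero_of_le k2 (by omega), qPoch_ne_zero_of_le k3 (by omega),
    qPoch_ne_zero_of_le k4 (by omega)]

/-- Dropping the first terms of a series and grouping the others into blocks. -/
theorem HasSum.blocks {T : ℕ → ℂ} {S : ℂ} (h : HasSum T S) (δ : ℕ) {L : ℕ} (hL : 0 < L) :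
    HasSum (fun n => ∑ i ∈ Ico δ (δ + L), T (i + n * L)) (S - ∑ k ∈ range δ, T k) := by
  have : NeZero L := ⟨hL.ne'⟩
  have h1 := (hasSum_nat_add_iff' δ).2 h
  have h2 := ((Nat.divModEquiv L).symm.hasSum_iff).2 h1
  refine (congrArg (HasSum · _) (funext fun n => ?_)).mpr (h2.prod_fiberwise fun n => hasSum_fintype _)
  rw [sum_Ico_eq_sum_range, Nat.add_sub_cancel_left, ← Fin.sum_univ_eq_sum_range
    (fun i => T (δ + i + n * L))]
  refine sum_congr rfl fun i _ => ?_
  simp only [Function.comp, Nat.divModEquiv_symm_apply]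
  congr 1
  ring

/-! ### The lattice path of the floor functions -/

namespace PatternData

/-- The vector `(ε_b, ε_c, ε_d, ε_e)`. -/
def eps (P : PatternData) : Fin 4 → ℕ := ![P.epsB, P.epsC, P.epsD, P.epsE]

/-- The vector `(λ_b, λ_c, λ_d, λ_e)`. -/
def lam (P : PatternData) : Fin 4 → ℕ := ![P.lamB, P.lamC, P.lamD, P.lamE]

/-- The vector `(⟨k⟩_b, ⟨k⟩_c, ⟨k⟩_d, ⟨k⟩_e)`. -/
def path (P : PatternData) (k : ℕ) (p : Fin 4) : ℕ := (P.eps p + k * P.lam p) / P.Lam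

theorem path_mono (P : PatternData) : Monotone P.path := fun m n h p => by
  unfold path
  gcongr

theorem sum_path {P : PatternData} (hP : P.IsPartition) (k : ℕ) : ∑ p, P.path k p = k := by
  rw [Fin.sum_univ_four]
  exact (hP k).symm

theorem exists_isPath {P : PatternData} (hP : P.IsPartition) : ∃ κ, IsPath κ P.path := by
  have h : ∀ k, ∃ p, P.path (k + 1) = P.path k + Pi.single p 1 := by
    intro k
    have hm := P.path_mono (Nat.le_succ k)
    have h0 := hm 0
    have h1 := hm 1
    have h2 := hm 2
    have h3 := hm 3
    have s0 := sum_path hP k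
    have s1 := sum_path hP (k + 1)
    rw [Fin.sum_univ_four] at s0 s1
    simp only [Nat.succ_eq_add_one] at h0 h1 h2 h3
    -- Four nondecreasing integers whose sum grows by 1: exactly one of them grows, and by 1.
    have hc : P.path (k + 1) 0 = P.path k 0 + 1 ∨ P.path (k + 1) 1 = P.path k 1 + 1 ∨
      P.path (k + 1) 2 = P.path k 2 + 1 ∨ P.path (k + 1) 3 = P.path k 3 + 1 := by omega
    rcases hc with hc | hc | hc | hc
    · refine ⟨0, funext fun p => ?_⟩
      fin_cases p <;> simp <;> omega
    · refine ⟨1, funext fun p => ?_⟩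
      fin_cases p <;> simp <;> omega
    · refine ⟨2, funext fun p => ?_⟩
      fin_cases p <;> simp <;> omega
    · refine ⟨3, funext fun p => ?_⟩
      fin_cases p <;> simp <;> omega
  choose κ hκ using h
  refine ⟨κ, ⟨funext fun p => ?_, hκ⟩⟩
  have h1 := single_le_sum (f := P.path 0) (fun _ _ => Nat.zero_le _) (mem_univ p)
  rw [sum_path hP 0] at h1
  exact Nat.le_zero.1 h1

/-- With e = qa²/(bcd) one has bcd/a = qa/e, qa/(bc) = de/a, and similarly for the other pairs,
which makes `H` symmetric in the four parameters. -/
theorem H_eq_ddQuot {P : PatternData} (hP : P.IsPartition) {q a b c d : ℂ} (hq : q ≠ 0)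
    (ha : a ≠ 0) (hb : b ≠ 0) (hc : c ≠ 0) (hd : d ≠ 0) (k : ℕ) :
    P.H q a b c d k = ddQuot q a (params q b c d a) (P.path k) := by
  have e0 : k = P.path k 0 + P.path k 1 + P.path k 2 + P.path k 3 := hP k
  have e1 : b * c * d / a = q * a / (q * a ^ 2 / (b * c * d)) := by field_simp
  have e2 : q * a / (b * c) = d * (q * a ^ 2 / (b * c * d)) / a := by field_simp
  have e3 : q * a / (b * d) = c * (q * a ^ 2 / (b * c * d)) / a := by field_simp
  have e4 : q * a / (c * d) = b * (q * a ^ 2 / (b * c * d)) / a := by field_simp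
  have f0 : P.nb k = P.path k 0 := rfl
  have f1 : P.nc k = P.path k 1 := rfl
  have f2 : P.nd k = P.path k 2 := rfl
  have f3 : P.ne k = P.path k 3 := rfl
  rw [H, ddQuot, f0, f1, f2, f3, ← e0, e1, e2, e3, e4]
  simp only [params, Matrix.cons_val]
  simp only [div_eq_mul_inv _ (_ * _), div_eq_mul_inv _ (qPoch _ _ _), mul_inv]
  ring

/-- The factors of φ pair up: (1 - q^j y x)(1 - q^j y/(ax)) is affine in x + 1/(ax). -/
theorem phi_eq_prod (P : PatternData) {q a b c d : ℂ} (hq : q ≠ 0) (ha : a ≠ 0) (hb : b ≠ 0)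
    (hc : c ≠ 0) (hd : d ≠ 0) (n k : ℕ) :
    P.phi q a b c d (q ^ n) k =
      ∏ p, ∏ j ∈ range (P.path k p), stepFactor q a (params q b c d a p) j n := by
  have h : ∀ y m, ∏ j ∈ range m, stepFactor q a y j n =
      qPoch (y * q ^ n) q m * qPoch (y / (a * q ^ n)) q m := by
    intro y m
    rw [qPoch, qPoch, ← prod_mul_distrib]
    refine prod_congr rfl fun j _ => ?_
    unfold stepFactor node
    field_simp
    ring
  have e1 : q * a ^ 2 * q ^ n / (b * c * d) = q * a ^ 2 / (b * c * d) * q ^ n := by ring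
  have e2 : q * a / (b * c * d * q ^ n) = q * a ^ 2 / (b * c * d) / (a * q ^ n) := by field_simp
  rw [Fin.prod_univ_four, h, h, h, h, phi, e1, e2]
  change _ = qPoch (b * q ^ n) q (P.nb k) * qPoch (b / (a * q ^ n)) q (P.nb k) *
    (qPoch (c * q ^ n) q (P.nc k) * qPoch (c / (a * q ^ n)) q (P.nc k)) *
    (qPoch (d * q ^ n) q (P.nd k) * qPoch (d / (a * q ^ n)) q (P.nd k)) *
    (qPoch (q * a ^ 2 / (b * c * d) * q ^ n) q (P.ne k) *
      qPoch (q * a ^ 2 / (b * c * d) / (a * q ^ n)) q (P.ne k))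
  ring

theorem phi_succ {P : PatternData} {κ : ℕ → Fin 4} (hN : IsPath κ P.path) {q a b c d : ℂ}
    (hq : q ≠ 0) (ha : a ≠ 0) (hb : b ≠ 0) (hc : c ≠ 0) (hd : d ≠ 0) (n k : ℕ) :
    P.phi q a b c d (q ^ n) (k + 1) = P.phi q a b c d (q ^ n) k *
      stepFactor q a (params q b c d a (κ k)) (P.path k (κ k)) n := by
  rw [phi_eq_prod P hq ha hb hc hd, phi_eq_prod P hq ha hb hc hd,
    ← prod_path hN (fun p j => stepFactor q a (params q b c d a p) j n),
    ← prod_path hN (fun p j => stepFactor q a (params q b c d a p) j n), prod_range_succ]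

theorem Theta_eq_prod {P : PatternData} {q a b c d : ℂ} (hq : q ≠ 0) (ha : a ≠ 0) (hb : b ≠ 0)
    (hc : c ≠ 0) (hd : d ≠ 0) (k : ℕ) :
    P.Theta q a b c d k = (∏ j ∈ range k, q ^ j) *
      ∏ p, ∏ j ∈ range (P.path k p), (a / params q b c d a p / q ^ j) := by
  have h : ∀ m, ∏ j ∈ range m, q ^ j = q ^ m.choose 2 := fun m => by
    rw [prod_pow_eq_pow_sum, sum_range_id, Nat.choose_two_right]
  have h2 : ∀ y m, ∏ j ∈ range m, (y / q ^ j) = y ^ m / q ^ m.choose 2 := fun y m => by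
    rw [prod_div_distrib, prod_const, card_range, h]
  have e1 : b * c * d / (q * a) = a / (q * a ^ 2 / (b * c * d)) := by field_simp
  rw [Fin.prod_univ_four, h, h2, h2, h2, h2, Theta, e1]
  change _ = q ^ k.choose 2 * ((a / b) ^ P.nb k / q ^ (P.nb k).choose 2 *
    ((a / c) ^ P.nc k / q ^ (P.nc k).choose 2) * ((a / d) ^ P.nd k / q ^ (P.nd k).choose 2) *
    ((a / (q * a ^ 2 / (b * c * d))) ^ P.ne k / q ^ (P.ne k).choose 2))
  rw [zpow_sub₀ hq, zpow_sub₀ hq, zpow_sub₀ hq, zpow_sub₀ hq]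
  simp only [zpow_natCast, div_eq_mul_inv (_ ^ _), div_eq_mul_inv (_ * _) (_ ^ _)]
  ring

theorem Theta_ne_zero {P : PatternData} {q a b c d : ℂ} (hq : q ≠ 0) (ha : a ≠ 0) (hb : b ≠ 0)
    (hc : c ≠ 0) (hd : d ≠ 0) (k : ℕ) : P.Theta q a b c d k ≠ 0 := by
  rw [Theta_eq_prod hq ha hb hc hd]
  refine mul_ne_zero (prod_ne_zero_iff.2 fun _ _ => pow_ne_zero _ hq)
    (prod_ne_zero_iff.2 fun p _ => prod_ne_zero_iff.2 fun _ _ => ?_)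
  exact div_ne_zero (div_ne_zero ha (params_ne_zero hq hb hc hd ha p)) (pow_ne_zero _ hq)

theorem Theta_succ {P : PatternData} {κ : ℕ → Fin 4} (hN : IsPath κ P.path) {q a b c d : ℂ}
    (hq : q ≠ 0) (ha : a ≠ 0) (hb : b ≠ 0) (hc : c ≠ 0) (hd : d ≠ 0) (k : ℕ) :
    P.Theta q a b c d (k + 1) = P.Theta q a b c d k *
      (q ^ k / q ^ P.path k (κ k) * (a / params q b c d a (κ k))) := by
  rw [Theta_eq_prod hq ha hb hc hd, Theta_eq_prod hq ha hb hc hd,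
    ← prod_path hN (fun p j => a / params q b c d a p / q ^ j),
    ← prod_path hN (fun p j => a / params q b c d a p / q ^ j), prod_range_succ, prod_range_succ]
  ring

theorem tendsto_sub_path {P : PatternData} {p : Fin 4} (hp : P.lam p < P.Lam) :
    Filter.Tendsto (fun k => k - P.path k p) Filter.atTop Filter.atTop := by
  refine Filter.tendsto_atTop.2 fun m => ?_
  -- Since λ_p + 1 ≤ Λ, the gap kΛ - kλ_p is at least k, so this threshold absorbs both ε_p and mΛ.
  filter_upwards [Filter.eventually_ge_atTop (P.eps p + m * P.Lam)] with k hk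
  have h : P.path k p + m ≤ k := by
    unfold path
    rw [← Nat.add_mul_div_right _ _ (by omega)]
    apply Nat.div_le_of_le_mul
    nlinarith [Nat.mul_le_mul_left k (Nat.succ_le_of_lt hp)]
  omega

theorem lam_le (P : PatternData) (p : Fin 4) : P.lam p ≤ P.Lam := by
  fin_cases p <;> simp [lam, Lam] <;> omega

/-- Ratio test. A step in direction p multiplies Θ by q^(k - ⟨k⟩_p) a/z_p. The power tends to 0 if
λ_p < Λ; if λ_p = Λ it is only bounded by 1, and |a/z_p| < 1 is needed. -/
theorem summable_norm_Theta {P : PatternData} {κ : ℕ → Fin 4} (hN : IsPath κ P.path)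
    {q a b c d : ℂ} (hq : q ≠ 0) (hq1 : ‖q‖ < 1) (ha : a ≠ 0) (hb : b ≠ 0) (hc : c ≠ 0)
    (hd : d ≠ 0) (hconv : ∀ p, P.lam p = P.Lam → ‖a / params q b c d a p‖ < 1) :
    Summable fun k => ‖P.Theta q a b c d k‖ := by
  have h : ∀ p, ∃ r < 1, ∀ᶠ k in Filter.atTop,
      ‖q ^ k / q ^ P.path k p * (a / params q b c d a p)‖ ≤ r := by
    intro p
    have hpow : ∀ k, q ^ k / q ^ P.path k p = q ^ (k - P.path k p) := fun k =>
      pow_div_pow_of_le hq (hN.le k p)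
    rcases (P.lam_le p).eq_or_lt with h1 | h1
    · refine ⟨_, hconv p h1, Filter.Eventually.of_forall fun k => ?_⟩
      rw [hpow, norm_mul, norm_pow]
      exact mul_le_of_le_one_left (norm_nonneg _) (pow_le_one₀ (norm_nonneg _) hq1.le)
    · refine ⟨1 / 2, by norm_num, ?_⟩
      have h2 := ((tendsto_pow_mul_zero hq1 (a / params q b c d a p)).comp
        (tendsto_sub_path h1)).norm
      rw [norm_zero] at h2
      filter_upwards [h2.eventually_le_const (show (0 : ℝ) < 1 / 2 by norm_num)] with k hk
      rw [hpow]
      exact hk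
  choose r hr1 hr using h
  obtain ⟨p0, hp0⟩ := Finite.exists_max r
  refine summable_of_ratio_norm_eventually_le (hr1 p0) ?_
  filter_upwards [Filter.eventually_all.2 hr] with k hk
  rw [norm_norm, norm_norm, Theta_succ hN hq ha hb hc hd, norm_mul, mul_comm]
  exact mul_le_mul_of_nonneg_right ((hk (κ k)).trans (hp0 _)) (norm_nonneg _)

end PatternData

end

/-! ### The series identity -/

theorem theorem2p1 (P : PatternData) (hP : P.IsPartition)
    (δ : ℕ) (hδ : δ < P.Lam)
    (q a b c d : ℂ) (hq0 : q ≠ 0) (hq1 : ‖q‖ < 1)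
    (ha : a ≠ 0) (hb : b ≠ 0) (hc : c ≠ 0) (hd : d ≠ 0)
    -- the denominators of the product side do not vanish
    (hDb : qPochInf (q * a / b) q ≠ 0) (hDc : qPochInf (q * a / c) q ≠ 0)
    (hDd : qPochInf (q * a / d) q ≠ 0) (hDe : qPochInf (b * c * d / a) q ≠ 0)
    -- the quotients `φ(q^k; k+1) / φ(q^k; k)` are defined
    (hphi : ∀ k : ℕ, P.phi q a b c d (q ^ k) k ≠ 0)
    -- convergence of the series when only one of the four `λ`s is nonzero
    (hcb : P.lamB = P.Lam → ‖a / b‖ < 1) (hcc : P.lamC = P.Lam → ‖a / c‖ < 1)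
    (hcd : P.lamD = P.Lam → ‖a / d‖ < 1)
    (hce : P.lamE = P.Lam → ‖b * c * d / (q * a)‖ < 1) :
    HasSum
      (fun n : ℕ =>
        P.H q a b c d (n * P.Lam) * P.Theta q a b c d (n * P.Lam) *
          ∑ i ∈ Finset.Ico δ (δ + P.Lam),
            P.Theta q a b c d (1 + i + n * P.Lam) / P.Theta q a b c d (n * P.Lam) *
            (P.phi q a b c d (q ^ (i + n * P.Lam)) (1 + i + n * P.Lam) /
              -P.phi q a b c d (q ^ (i + n * P.Lam)) (i + n * P.Lam)) *
            (P.H q a b c d (i + n * P.Lam) / P.H q a b c d (n * P.Lam)))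
      (qPochInf b q * qPochInf c q * qPochInf d q * qPochInf (q * a ^ 2 / (b * c * d)) q /
          (qPochInf (q * a / b) q * qPochInf (q * a / c) q * qPochInf (q * a / d) q *
            qPochInf (b * c * d / a) q) -
        ∑ k ∈ Finset.range δ,
          P.Theta q a b c d (k + 1) *
            (P.phi q a b c d (q ^ k) (k + 1) / -P.phi q a b c d (q ^ k) k) *
            P.H q a b c d k) := by
  obtain ⟨κ, hN⟩ := PatternData.exists_isPath hP
  have hH := PatternData.H_eq_ddQuot hP hq0 ha hb hc hd
  have e1 : q * a / (q * a ^ 2 / (b * c * d)) = b * c * d / a := by field_simp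
  have e2 : a / (q * a ^ 2 / (b * c * d)) = b * c * d / (q * a) := by field_simp
  have hD : ∀ p, qPochInf (q * a / params q b c d a p) q ≠ 0 := by
    intro p
    fin_cases p
    · exact hDb
    · exact hDc
    · exact hDd
    · change qPochInf (q * a / (q * a ^ 2 / (b * c * d))) q ≠ 0
      rwa [e1]
  have hconv : ∀ p, P.lam p = P.Lam → ‖a / params q b c d a p‖ < 1 := by
    intro p
    fin_cases p
    · exact hcb
    · exact hcc
    · exact hcd
    · change P.lamE = P.Lam → ‖a / (q * a ^ 2 / (b * c * d))‖ < 1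
      rwa [e2]
  have hθ0 : P.Theta q a b c d 0 = 1 := by
    rw [PatternData.Theta_eq_prod hq0 ha hb hc hd, hN.zero]
    simp
  have hsum := hasSum_path hN hq0 hq1 hb hc hd ha rfl hD hθ0
    (PatternData.Theta_succ hN hq0 ha hb hc hd)
    (PatternData.summable_norm_Theta hN hq0 hq1 ha hb hc hd hconv)
  set T : ℕ → ℂ := fun k => P.Theta q a b c d (k + 1) *
    (P.phi q a b c d (q ^ k) (k + 1) / -P.phi q a b c d (q ^ k) k) * P.H q a b c d k with hT
  -- The monomial in `stepFactor_eq` is minus the inverse of the ratio Θ(k+1)/Θ(k); this accounts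
  -- for the sign in the quotient of φ's.
  have hterm : (fun k => P.Theta q a b c d k * ddQuot q a (params q b c d a) (P.path k) *
      stepUnit q a (params q b c d a (κ k)) (P.path k (κ k)) k) = T := by
    funext k
    have h0 := hphi k
    have hz := params_ne_zero hq0 hb hc hd ha (κ k)
    simp only [hT]
    rw [PatternData.phi_succ hN hq0 ha hb hc hd, PatternData.Theta_succ hN hq0 ha hb hc hd, hH,
      stepFactor_eq hq0 ha hz]
    field_simp
  rw [hterm] at hsum
  simp only [params, Matrix.cons_val, e1] at hsum
  refine (congrArg (HasSum · _) (funext fun n => ?_)).mpr (hsum.blocks δ (Nat.zero_lt_of_lt hδ))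
  rw [mul_sum]
  refine sum_congr rfl fun i _ => ?_
  have hΘ := PatternData.Theta_ne_zero (P := P) hq0 ha hb hc hd (n * P.Lam)
  rw [hT, show 1 + i + n * P.Lam = i + n * P.Lam + 1 by ring]
  -- Cancelling `H` at nΛ needs it nonzero; otherwise all later values of `H` vanish and both sides
  -- are 0.
  by_cases h0 : P.H q a b c d (n * P.Lam) = 0
  · have h1 : P.H q a b c d (i + n * P.Lam) = 0 := by
      rw [hH] at h0 ⊢
      exact ddQuot_eq_zero_of_le (P.path_mono (Nat.le_add_left _ _)) h0
    simp [h0, h1]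
  · field_simp
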